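/- Let $\Psi=\{X_n\}$ be a homogeneous Poisson point process of intensity $\lambda>0$ on $\mathbb{R}^2$, and let $0<\gamma<1$. Thin $\Psi$ independently: each point is selected, independently of the other points and of their positions, with probability $\gamma$. The selected points (the aggregators) form the process $\Psi_a$, of density $\lambda_a=\gamma\lambda$; the remaining points (the devices) form the process $\Psi_u$, of density $\lambda_u=\lambda-\lambda_a$. Let $\alpha>0$ be the path loss exponent, $P_{T_{\max}}>0$ the maximum transmit power and $\bar P_T>0$ the target received power. A device at distance $d$ from its aggregator transmits with power $\min\{P_{T_{\max}},\bar P_T d^{\alpha}\}$, so that its received power is $P_R(d)=\min\{P_{T_{\max}}d^{-\alpha},\bar P_T\}$ (with $P_R(0)=\bar P_T$). Let $r_c=(P_{T_{\max}}/\bar P_T)^{1/\alpha}$ and $\Gamma(s,x)=\int_x^\infty t^{s-1}e^{-t}\,dt$ for $s\in\mathbb{R}$, $x>0$. For $x\in\Psi_a$ let $V_x=\{y\in\mathbb{R}^2:\|y-x\|\le\|y-z\|\text{ for all }z\in\Psi_a\}$ be its Voronoi cell. Let $\mathbb{E}^0_{\Psi_a}$ be the Palm expectation with respect to $\Psi_a$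 (the expectation for a typical aggregator, placed at the origin): for a nonnegative measurable functional $F$ and any Borel set $B\subset\mathbb{R}^2$ of positive finite area, $$\mathbb{E}^0_{\Psi_a}\big[F(\Psi_a,\Psi_u)\big]=\frac{\mathbb{E}\sum_{x\in\Psi_a\cap B}F(\Psi_a-x,\Psi_u-x)}{\mathbb{E}\,\#(\Psi_a\cap B)}.$$ Then the mean total received power at the typical aggregator from the devices in its Voronoi cell is $$\mathbb{E}^0_{\Psi_a}\Big[\sum_{y\in\Psi_u\cap V_0}P_R(\|y\|)\Big]=\frac{\lambda_u}{\lambda_a}\Big(1-e^{-\pi\lambda_a r_c^2}\Big)\bar P_T+\frac{\pi\lambda_u}{(\pi\lambda_a)^{1-\alpha/2}}\,P_{T_{\max}}\,\Gamma\Big(1-\frac{\alpha}{2},\pi\lambda_a r_c^2\Big).$$ -/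

import Mathlib

open MeasureTheory ProbabilityTheory
open scoped ENNReal NNReal

noncomputable section

namespace DataAggregation

/-- The Euclidean plane. -/
abbrev Plane : Type := EuclideanSpace ℝ (Fin 2)

variable {Ω : Type*} [MeasurableSpace Ω]

/-- The random number (with values in `ℕ∞`) of points of the sequence `X` that lie in `B`. -/
def count (X : ℕ → Ω → Plane) (B : Set Plane) (ω : Ω) : ℕ∞ :=
  {n : ℕ | X n ω ∈ B}.encard

/-- `X` is a measurable enumeration, without repetitions, of the points of a homogeneous Poisson
point process with intensity `lam` on the plane: the number of points in a Borel set `B` of finite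
area has the Poisson law with mean `lam * |B|`, and the numbers of points in disjoint sets are
independent. -/
structure IsPoissonProcess (μ : Measure Ω) (lam : ℝ) (X : ℕ → Ω → Plane) : Prop where
  measurable : ∀ n, Measurable (X n)
  injective : ∀ᵐ ω ∂μ, Function.Injective fun n => X n ω
  count_law : ∀ B : Set Plane, MeasurableSet B → volume B < ∞ → ∀ k : ℕ,
    μ {ω | count X B ω = k} = poissonMeasure (ENNReal.ofReal lam * volume B).toNNReal {k}
  count_indep : ∀ (m : ℕ) (B : Fin m → Set Plane), (∀ i, MeasurableSet (B i)) →
    (∀ i, volume (B i) < ∞) → Pairwise (fun i j => Disjoint (B i) (B j)) →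
    iIndepFun (fun i => count X (B i)) μ

/-- The marks of an independent thinning of the points `X` with selection probability `p`: the
`U n` are independent, `U n = true` (the point `X n` is selected) has probability `p`, and the
marks are independent of the points. -/
structure IsThinning (μ : Measure Ω) (p : ℝ) (X : ℕ → Ω → Plane) (U : ℕ → Ω → Bool) : Prop where
  measurable : ∀ n, Measurable (U n)
  prob : ∀ n, μ {ω | U n ω = true} = ENNReal.ofReal p
  indep : iIndepFun U μ
  indep_points : IndepFun (fun ω n => X n ω) (fun ω n => U n ω) μ

/-- The random set of all points whose mark is `b`. -/
def pointsWithMark (X : ℕ → Ω → Plane) (U : ℕ → Ω → Bool) (b : Bool) (ω : Ω) : Set Plane :=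
  {x | ∃ n, U n ω = b ∧ X n ω = x}

/-- The aggregator process: the selected points. -/
def aggregators (X : ℕ → Ω → Plane) (U : ℕ → Ω → Bool) : Ω → Set Plane :=
  pointsWithMark X U true

/-- The process of transmitting devices: the points that are not selected. -/
def devices (X : ℕ → Ω → Plane) (U : ℕ → Ω → Bool) : Ω → Set Plane :=
  pointsWithMark X U false

/-- The Voronoi cell of the site `x` with respect to the set of sites `A`. -/
def voronoiCell (A : Set Plane) (x : Plane) : Set Plane :=
  {y | ∀ z ∈ A, dist y x ≤ dist y z}

/-- The Palm expectation, with respect to the stationary point process `Φ`, of the functional `F`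
of the pair `(Φ, Ξ)`, computed with the window `B`: the expectation of the sum, over the points `x`
of `Φ` in `B`, of the value of `F` on the configuration as seen from `x` (translated so that `x` is
moved to the origin), divided by the expected number of points of `Φ` in `B`. -/
def palmExpectation (μ : Measure Ω) (Φ Ξ : Ω → Set Plane) (B : Set Plane)
    (F : Set Plane → Set Plane → ℝ≥0∞) : ℝ≥0∞ :=
  (∫⁻ ω, ∑' x : ↥(Φ ω ∩ B),
      F ((fun y => y - (x : Plane)) '' Φ ω) ((fun y => y - (x : Plane)) '' Ξ ω) ∂μ) /
    ∫⁻ ω, ((Φ ω ∩ B).encard : ℝ≥0∞) ∂μ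

/-- The power received from a device at distance `d` under truncated power control,
`min (Pmax * d ^ (-α)) PT`. In `ℝ≥0∞` one has `0 ^ (-α) = ∞` for `α > 0`, so the value at `d = 0`
is `PT`. -/
def receivedPower (Pmax PT α d : ℝ) : ℝ≥0∞ :=
  min (ENNReal.ofReal Pmax * ENNReal.ofReal d ^ (-α)) (ENNReal.ofReal PT)

/-- The total power received by an aggregator at the origin from the devices in its Voronoi cell,
where `A` is the set of aggregators and `D` the set of devices. -/
def totalReceivedPower (Pmax PT α : ℝ) (A D : Set Plane) : ℝ≥0∞ :=
  ∑' y : ↥(D ∩ voronoiCell A 0), receivedPower Pmax PT α ‖(y : Plane)‖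

/-- The upper incomplete gamma function. -/
def upperIncompleteGamma (s x : ℝ) : ℝ :=
  ∫ t in Set.Ioi x, t ^ (s - 1) * Real.exp (-t)

/-- The critical distance, beyond which a device transmits with maximum power. -/
def criticalDistance (Pmax PT α : ℝ) : ℝ := (Pmax / PT) ^ (1 / α)

end DataAggregation

end

/-! The total power is a sum over ordered pairs of distinct points (x, y) with x ∈ B: y is a device
served by x exactly when x is selected and no point strictly closer to y than x is. Given the
points, this has probability γ q^N, where q = 1 - γ and N counts the points in the open ball around
y with x on its boundary (`tsum_totalReceivedPower`, `lintegral_nearestSelected`).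

What remains is a two-point Mecke formula with weight q^N (`tsum_lintegral_pow_natCount_ball`): the
pairs have density λ² q exp(-λ(1 - q)π|x - y|²). The exponential is the generating function of a
Poisson count; the factor q appears because y lies in its own ball, while x does not. Only the count
axioms are available, so for a fixed set D the formula is first checked on rectangles A × C with A,
C disjoint and each inside or outside D, where independence gives it (`weightedPairs_pow_natCount`).
It passes to sets depending on the pair through countably many values, and then to the true ball by
approximation from inside and dominated convergence.

Since λγ = λ_a, λq = λ_u and the mean number of aggregators in B is λ_a|B|, translation invariance
reduces the Palm expectation to λ_u ∫ exp(-πλ_a|y|²) P_R(|y|) dy. Polar coordinates, split at r_c,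
give the two terms (`lintegral_exp_mul_receivedPower`). -/

namespace DataAggregation

/-! ### Generating functions of the Poisson law. -/

lemma lintegral_pow_poissonMeasure (r : ℝ≥0) {q : ℝ} (hq : 0 ≤ q) :
    ∫⁻ k, ENNReal.ofReal q ^ k ∂(poissonMeasure r) = ENNReal.ofReal (Real.exp (-(r * (1 - q)))) := by
  rw [lintegral_countable']
  have h : HasSum (fun k : ℕ => Real.exp (-r) * ((r * q) ^ k / k.factorial))
      (Real.exp (-r) * Real.exp (r * q)) := by
    have := NormedSpace.expSeries_div_hasSum_exp (r * q : ℝ)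
    rw [← Real.exp_eq_exp_ℝ] at this
    exact this.mul_left _
  have e : Real.exp (-(r * (1 - q))) = Real.exp (-r) * Real.exp (r * q) := by
    rw [← Real.exp_add]; ring_nf
  rw [e, ← h.tsum_eq, ENNReal.ofReal_tsum_of_nonneg (fun k => by positivity) h.summable]
  refine tsum_congr fun k => ?_
  rw [poissonMeasure_singleton, ← ENNReal.ofReal_pow hq, ← ENNReal.ofReal_mul (by positivity)]
  congr 1
  ring

lemma lintegral_mul_pow_poissonMeasure (r : ℝ≥0) {q : ℝ} (hq : 0 ≤ q) :
    ∫⁻ k, (k : ℝ≥0∞) * ENNReal.ofReal q ^ k ∂(poissonMeasure r) =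
      r * ENNReal.ofReal q * ENNReal.ofReal (Real.exp (-(r * (1 - q)))) := by
  -- The term k = 0 vanishes; shifting the index cancels the factor k against the factorial and
  -- leaves rq times the generating function.
  rw [← lintegral_pow_poissonMeasure r hq, lintegral_countable', lintegral_countable',
    tsum_eq_zero_add' ENNReal.summable, ← ENNReal.tsum_mul_left]
  simp only [CharP.cast_eq_zero, zero_mul, zero_add]
  refine tsum_congr fun k => ?_
  rw [poissonMeasure_singleton, poissonMeasure_singleton, ← ENNReal.ofReal_pow hq,
    ← ENNReal.ofReal_pow hq, ← ENNReal.ofReal_natCast, ← ENNReal.ofReal_coe_nnreal]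
  repeat rw [← ENNReal.ofReal_mul (by positivity)]
  congr 1
  have : ((k + 1).factorial : ℝ) = (k + 1) * k.factorial := by
    rw [Nat.factorial_succ]; push_cast; ring
  rw [this]
  push_cast
  field_simp
  ring

/-! ### Point counts. -/

section Count

variable {Ω : Type*}

lemma toENNReal_count (X : ℕ → Ω → Plane) (B : Set Plane) (ω : Ω) :
    (count X B ω : ℝ≥0∞) = ∑' n, B.indicator 1 (X n ω) := by
  rw [count, ← ENNReal.tsum_set_one, tsum_subtype {n : ℕ | X n ω ∈ B} (fun _ => (1 : ℝ≥0∞))]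
  rfl

variable [MeasurableSpace Ω] {μ : Measure Ω} {lam : ℝ} {X : ℕ → Ω → Plane}

/-- The set may be random because the counts needed later are over balls determined by the points
themselves. -/
lemma measurable_count_random {D : Ω → Set Plane} (hD : ∀ n, MeasurableSet {ω | X n ω ∈ D ω}) :
    Measurable fun ω => count X (D ω) ω := by
  have h : Measurable fun ω => (count X (D ω) ω : ℝ≥0∞) := by
    simp only [toENNReal_count]
    refine Measurable.tsum fun n => ?_
    have e : (fun ω => (D ω).indicator (1 : Plane → ℝ≥0∞) (X n ω)) =
        {ω | X n ω ∈ D ω}.indicator 1 := rfl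
    rw [e]
    exact measurable_one.indicator (hD n)
  refine measurable_to_countable' fun k => ?_
  have : (fun ω => count X (D ω) ω) ⁻¹' {k} =
      (fun ω => (count X (D ω) ω : ℝ≥0∞)) ⁻¹' {(k : ℝ≥0∞)} := by
    ext ω; simp
  rw [this]
  exact h (measurableSet_singleton _)

lemma measurable_count (hX : ∀ n, Measurable (X n)) {B : Set Plane} (hB : MeasurableSet B) :
    Measurable (count X B) :=
  measurable_count_random fun n => hX n hB

/-- The number of points of the sequence `X` in `B`, with value `0` if there are infinitely many. -/
noncomputable def natCount (X : ℕ → Ω → Plane) (B : Set Plane) (ω : Ω) : ℕ := (count X B ω).toNat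

lemma measurable_natCount (hX : ∀ n, Measurable (X n)) {B : Set Plane} (hB : MeasurableSet B) :
    Measurable (natCount X B) :=
  (measurable_of_countable ENat.toNat).comp (measurable_count hX hB)

variable [IsProbabilityMeasure μ]

/-- The Poisson masses of the finite values already sum to 1, so none is left for `⊤`. -/
lemma IsPoissonProcess.ae_count_ne_top (hX : IsPoissonProcess μ lam X) {B : Set Plane}
    (hB : MeasurableSet B) (hB' : volume B < ∞) : ∀ᵐ ω ∂μ, count X B ω ≠ ⊤ := by
  have hm := measurable_count hX.measurable hB
  have e : {ω | count X B ω ≠ ⊤} = ⋃ k : ℕ, {ω | count X B ω = k} := by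
    ext ω
    simp only [Set.mem_ofPred_eq, Set.mem_iUnion, ENat.ne_top_iff_exists, eq_comm]
  have hms : ∀ k : ℕ, MeasurableSet {ω | count X B ω = k} := fun k =>
    hm (measurableSet_singleton _)
  have h1 : μ {ω | count X B ω ≠ ⊤} = 1 := by
    rw [e, measure_iUnion _ hms]
    · simp only [hX.count_law B hB hB']
      rw [← measure_univ (μ := poissonMeasure (ENNReal.ofReal lam * volume B).toNNReal),
        ← Set.iUnion_of_singleton ℕ, measure_iUnion _ fun _ => measurableSet_singleton _]
      intro i j hij
      simpa using hij
    · intro i j hij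
      refine Set.disjoint_left.2 fun ω h h' => hij ?_
      simpa using h.symm.trans h'
  exact mem_ae_iff.2 ((prob_compl_eq_zero_iff (e ▸ MeasurableSet.iUnion hms)).2 h1)

lemma IsPoissonProcess.map_natCount (hX : IsPoissonProcess μ lam X) {B : Set Plane}
    (hB : MeasurableSet B) (hB' : volume B < ∞) :
    μ.map (natCount X B) = poissonMeasure (ENNReal.ofReal lam * volume B).toNNReal := by
  refine Measure.ext_of_singleton fun k => ?_
  rw [Measure.map_apply (measurable_natCount hX.measurable hB) (measurableSet_singleton _),
    ← hX.count_law B hB hB' k]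
  refine measure_congr ?_
  filter_upwards [hX.ae_count_ne_top hB hB'] with ω hω
  refine propext ?_
  change (count X B ω).toNat = k ↔ count X B ω = k
  obtain ⟨m, hm⟩ := ENat.ne_top_iff_exists.1 hω
  simp [← hm]

end Count

/-! ### The pair formula for a fixed set. -/

/-- The law of the pairs of distinct points of the sequence `X`, counted with the weight `w`. -/
noncomputable def weightedPairs {Ω : Type*} [MeasurableSpace Ω] (μ : Measure Ω) (X : ℕ → Ω → Plane)
    (w : Ω → ℝ≥0∞) : Measure (Plane × Plane) :=
  Measure.sum fun p : {p : ℕ × ℕ // p.1 ≠ p.2} =>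
    (μ.withDensity w).map fun ω => (X p.1.1 ω, X p.1.2 ω)

lemma volume_diagonal : volume (Set.diagonal Plane) = 0 := by
  rw [Measure.volume_eq_prod, Measure.prod_apply measurableSet_diagonal]
  have : ∀ x : Plane, Prod.mk x ⁻¹' Set.diagonal Plane = {x} := by
    intro x; ext y; simp [eq_comm]
  simp [this]

section Count

variable {Ω : Type*} {X : ℕ → Ω → Plane}

lemma natCount_eq_natCount_sdiff_add {A D : Set Plane} (hA : A ⊆ D) {ω : Ω}
    (h : count X D ω ≠ ⊤) : natCount X D ω = natCount X (D \ A) ω + natCount X A ω := by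
  have e : count X D ω = count X (D \ A) ω + count X A ω := by
    rw [count, count, count, ← Set.encard_union_eq]
    · congr 1
      ext n
      by_cases hn : X n ω ∈ A
      · simp [hn, hA hn]
      · simp [hn]
    · exact Set.disjoint_left.2 fun n hn hn' => hn.2 hn'
  rw [e] at h
  rw [natCount, e, ENat.toNat_add (fun h' => h (by simp [h'])) (fun h' => h (by simp [h']))]
  rfl

/-- Here `qA` is the factor that each point of `A` contributes to the weight: `q` inside `D`, 1
outside. -/
lemma pow_natCount_eq {A D : Set Plane} {q qA : ℝ≥0∞}
    (hA : A ⊆ D ∧ qA = q ∨ Disjoint A D ∧ qA = 1) {ω : Ω} (h : count X D ω ≠ ⊤) :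
    q ^ natCount X D ω = q ^ natCount X (D \ A) ω * qA ^ natCount X A ω := by
  rcases hA with ⟨hA, rfl⟩ | ⟨hA, rfl⟩
  · rw [natCount_eq_natCount_sdiff_add hA h, pow_add]
  · rw [hA.symm.sdiff_eq_left, one_pow, mul_one]

/-- Disjointness makes the excluded pairs n = m contribute nothing, so the double sum factors. -/
lemma tsum_indicator_prod {A C : Set Plane} (h : Disjoint A C) (ω : Ω) :
    ∑' p : {p : ℕ × ℕ // p.1 ≠ p.2}, (A ×ˢ C).indicator (1 : Plane × Plane → ℝ≥0∞)
      (X p.1.1 ω, X p.1.2 ω) = count X A ω * count X C ω := by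
  rw [toENNReal_count, toENNReal_count, ← ENNReal.tsum_mul_right]
  simp_rw [← ENNReal.tsum_mul_left]
  rw [← ENNReal.tsum_prod]
  refine (tsum_subtype {p : ℕ × ℕ | p.1 ≠ p.2}
    fun p => (A ×ˢ C).indicator (1 : Plane × Plane → ℝ≥0∞) (X p.1 ω, X p.2 ω)).trans ?_
  refine tsum_congr fun p => ?_
  rcases p with ⟨n, m⟩
  rcases eq_or_ne n m with rfl | hnm
  · rw [Set.indicator_of_notMem (by simp)]
    by_cases hA : X n ω ∈ A
    · simp [Set.disjoint_left.1 h hA]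
    · simp [hA]
  · rw [Set.indicator_of_mem (by simpa using hnm)]
    by_cases hA : X n ω ∈ A <;> by_cases hC : X m ω ∈ C <;> simp [hA, hC]

variable [MeasurableSpace Ω] {μ : Measure Ω} {lam : ℝ}

lemma lintegral_weightedPairs (hX : ∀ n, Measurable (X n)) {w : Ω → ℝ≥0∞} (hw : Measurable w)
    {f : Plane × Plane → ℝ≥0∞} (hf : Measurable f) :
    ∫⁻ z, f z ∂(weightedPairs μ X w) =
      ∑' p : {p : ℕ × ℕ // p.1 ≠ p.2}, ∫⁻ ω, w ω * f (X p.1.1 ω, X p.1.2 ω) ∂μ := by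
  rw [weightedPairs, lintegral_sum_measure]
  refine tsum_congr fun p => ?_
  have hm : Measurable fun ω => (X p.1.1 ω, X p.1.2 ω) := (hX _).prodMk (hX _)
  rw [lintegral_map hf hm]
  exact lintegral_withDensity_eq_lintegral_mul _ hw (hf.comp hm)

lemma weightedPairs_prod (hX : ∀ n, Measurable (X n)) {w : Ω → ℝ≥0∞} (hw : Measurable w)
    {A C : Set Plane} (hA : MeasurableSet A) (hC : MeasurableSet C) (h : Disjoint A C) :
    weightedPairs μ X w (A ×ˢ C) = ∫⁻ ω, w ω * (count X A ω * count X C ω) ∂μ := by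
  rw [← lintegral_indicator_one (hA.prod hC), lintegral_weightedPairs hX hw
    (measurable_one.indicator (hA.prod hC)), ← lintegral_tsum]
  · simp_rw [ENNReal.tsum_mul_left, tsum_indicator_prod h]
  · intro p
    exact (hw.mul ((measurable_one.indicator (hA.prod hC)).comp
      ((hX _).prodMk (hX _)))).aemeasurable

lemma weightedPairs_diagonal (hX : IsPoissonProcess μ lam X) {w : Ω → ℝ≥0∞} :
    weightedPairs μ X w (Set.diagonal Plane) = 0 := by
  have hd : MeasurableSet (Set.diagonal Plane) := measurableSet_diagonal
  rw [weightedPairs, Measure.sum_apply _ hd, ENNReal.tsum_eq_zero]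
  intro p
  rw [Measure.map_apply ((hX.measurable _).prodMk (hX.measurable _)) hd]
  refine withDensity_absolutelyContinuous μ w ?_
  refine measure_mono_null ?_ (ae_iff.1 hX.injective)
  intro ω hω hi
  exact p.2 (hi hω)

/-- The density of the pairs of points of a Poisson process weighted with `q ^ N(D)`. -/
noncomputable def pairDensity (lam q : ℝ) (D : Set Plane) (z : Plane × Plane) : ℝ≥0∞ :=
  ENNReal.ofReal lam ^ 2 * ENNReal.ofReal (Real.exp (-(lam * (1 - q) * volume.real D))) *
    ((D.indicator (fun _ => ENNReal.ofReal q) z.1 + Dᶜ.indicator 1 z.1) *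
    (D.indicator (fun _ => ENNReal.ofReal q) z.2 + Dᶜ.indicator 1 z.2))

lemma measurable_pairDensity {q : ℝ} {D : Set Plane} (hD : MeasurableSet D) :
    Measurable (pairDensity lam q D) := by
  have h : Measurable fun x : Plane =>
      D.indicator (fun _ => ENNReal.ofReal q) x + Dᶜ.indicator (1 : Plane → ℝ≥0∞) x :=
    (measurable_const.indicator hD).add (measurable_one.indicator hD.compl)
  exact measurable_const.mul ((h.comp measurable_fst).mul (h.comp measurable_snd))

lemma withDensity_pairDensity_prod {q qA qC : ℝ} {A C D : Set Plane}
    (hAm : MeasurableSet A) (hCm : MeasurableSet C)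
    (hA : A ⊆ D ∧ qA = q ∨ Disjoint A D ∧ qA = 1) (hC : C ⊆ D ∧ qC = q ∨ Disjoint C D ∧ qC = 1) :
    (volume : Measure (Plane × Plane)).withDensity (pairDensity lam q D) (A ×ˢ C) =
      ENNReal.ofReal lam ^ 2 * ENNReal.ofReal (Real.exp (-(lam * (1 - q) * volume.real D))) *
        (ENNReal.ofReal qA * ENNReal.ofReal qC) * (volume A * volume C) := by
  rw [withDensity_apply _ (hAm.prod hCm), setLIntegral_congr_fun (g := fun _ =>
    ENNReal.ofReal lam ^ 2 * ENNReal.ofReal (Real.exp (-(lam * (1 - q) * volume.real D))) *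
        (ENNReal.ofReal qA * ENNReal.ofReal qC)) (hAm.prod hCm), setLIntegral_const,
    Measure.volume_eq_prod, Measure.prod_prod]
  rintro ⟨x, y⟩ ⟨hx, hy⟩
  have key : ∀ {A : Set Plane} {qA : ℝ} {x : Plane}, x ∈ A →
      (A ⊆ D ∧ qA = q ∨ Disjoint A D ∧ qA = 1) →
      D.indicator (fun _ => ENNReal.ofReal q) x + Dᶜ.indicator (1 : Plane → ℝ≥0∞) x =
        ENNReal.ofReal qA := by
    rintro A qA x hx (⟨h, rfl⟩ | ⟨h, rfl⟩)
    · simp [h hx]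
    · simp [Set.disjoint_left.1 h hx]
  simp only [pairDensity, key hx hA, key hy hC]

/-- Splitting `D` along `A` and `C` writes the integrand as a product of functions of the counts in
three disjoint sets. These are independent, and each factor is a Poisson generating function or its
first-moment version. -/
lemma lintegral_pow_mul_count_mul_count [IsProbabilityMeasure μ] (hX : IsPoissonProcess μ lam X)
    (hlam : 0 ≤ lam) {q qA qC : ℝ} (hq : 0 ≤ q)
    {A C D : Set Plane} (hAm : MeasurableSet A) (hCm : MeasurableSet C) (hDm : MeasurableSet D)
    (hA' : volume A < ∞) (hC' : volume C < ∞) (hD' : volume D < ∞) (hAC : Disjoint A C)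
    (hA : A ⊆ D ∧ qA = q ∨ Disjoint A D ∧ qA = 1) (hC : C ⊆ D ∧ qC = q ∨ Disjoint C D ∧ qC = 1) :
    ∫⁻ ω, ENNReal.ofReal q ^ natCount X D ω * (count X A ω * count X C ω) ∂μ =
      ENNReal.ofReal lam ^ 2 * ENNReal.ofReal (Real.exp (-(lam * (1 - q) * volume.real D))) *
        (ENNReal.ofReal qA * ENNReal.ofReal qC) * (volume A * volume C) := by
  have hqA : 0 ≤ qA := by rcases hA with h | h <;> rw [h.2] <;> simp [hq]
  have hqC : 0 ≤ qC := by rcases hC with h | h <;> rw [h.2] <;> simp [hq]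
  have hE' : volume (D \ A) < ∞ := (measure_mono Set.sdiff_subset).trans_lt hD'
  have hF' : volume ((D \ A) \ C) < ∞ := (measure_mono Set.sdiff_subset).trans_lt hE'
  have hFm : MeasurableSet ((D \ A) \ C) := (hDm.diff hAm).diff hCm
  -- The alternative for `C` survives the removal of `A`, so the splitting can be iterated.
  have hC2 : C ⊆ D \ A ∧ qC = q ∨ Disjoint C (D \ A) ∧ qC = 1 := by
    rcases hC with h | h
    · exact Or.inl ⟨Set.subset_sdiff.2 ⟨h.1, hAC.symm⟩, h.2⟩
    · exact Or.inr ⟨h.1.mono_right Set.sdiff_subset, h.2⟩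
  -- splitting the volume of `D`
  have split : ∀ {A D : Set Plane} {qA : ℝ}, MeasurableSet A → volume D < ∞ →
      (A ⊆ D ∧ qA = q ∨ Disjoint A D ∧ qA = 1) →
      (1 - q) * volume.real D = (1 - q) * volume.real (D \ A) + (1 - qA) * volume.real A := by
    rintro A D qA hAm hD' (⟨h, rfl⟩ | ⟨h, rfl⟩)
    · rw [measureReal_sdiff h hAm hD'.ne]; ring
    · rw [h.symm.sdiff_eq_left]; ring
  have hsum := split hAm hD' hA
  rw [split hCm hE' hC2] at hsum
  let B : Fin 3 → Set Plane := ![A, C, (D \ A) \ C]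
  let φ : Fin 3 → ℕ∞ → ℝ≥0∞ := ![fun k => (k.toNat : ℝ≥0∞) * ENNReal.ofReal qA ^ k.toNat,
    fun k => (k.toNat : ℝ≥0∞) * ENNReal.ofReal qC ^ k.toNat, fun k => ENNReal.ofReal q ^ k.toNat]
  have hBm : ∀ i, MeasurableSet (B i) := by
    intro i; fin_cases i <;> assumption
  have hB' : ∀ i, volume (B i) < ∞ := by
    intro i; fin_cases i <;> assumption
  have hdisj : Pairwise fun i j => Disjoint (B i) (B j) := by
    have h02 : Disjoint A ((D \ A) \ C) :=
      (Set.disjoint_sdiff_right (s := A) (t := D)).mono_right Set.sdiff_subset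
    have h12 : Disjoint C ((D \ A) \ C) := Set.disjoint_sdiff_right
    intro i j hij
    fin_cases i <;> fin_cases j <;>
      first
      | exact absurd rfl hij
      | exact hAC
      | exact hAC.symm
      | exact h02
      | exact h02.symm
      | exact h12
      | exact h12.symm
  have hind := (hX.count_indep 3 B hBm hB' hdisj).comp φ fun i => measurable_of_countable _
  have hprod := lintegral_prod_eq_prod_lintegral_of_indepFun Finset.univ _ hind fun i =>
    (measurable_of_countable (φ i)).comp (measurable_count hX.measurable (hBm i))
  simp only [Fin.prod_univ_three] at hprod
  have hlaw : ∀ {S : Set Plane} (_ : MeasurableSet S) (_ : volume S < ∞) (ψ : ℕ → ℝ≥0∞),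
      ∫⁻ ω, ψ (count X S ω).toNat ∂μ =
        ∫⁻ k, ψ k ∂(poissonMeasure (ENNReal.ofReal lam * volume S).toNNReal) := by
    intro S hS hS' ψ
    rw [← hX.map_natCount hS hS', lintegral_map (measurable_of_countable ψ)
      (measurable_natCount hX.measurable hS)]
    rfl
  calc _ = ∫⁻ ω, φ 0 (count X (B 0) ω) * φ 1 (count X (B 1) ω) * φ 2 (count X (B 2) ω) ∂μ := by
        refine lintegral_congr_ae ?_
        filter_upwards [hX.ae_count_ne_top hAm hA', hX.ae_count_ne_top hCm hC',
          hX.ae_count_ne_top hDm hD', hX.ae_count_ne_top (hDm.diff hAm) hE'] with ω h1 h2 h3 h4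
        have e1 : ((count X A ω).toNat : ℝ≥0∞) = count X A ω := by
          rw [← ENat.toENNReal_coe, ENat.natCast_toNat h1]
        have e2 : ((count X C ω).toNat : ℝ≥0∞) = count X C ω := by
          rw [← ENat.toENNReal_coe, ENat.natCast_toNat h2]
        rw [pow_natCount_eq (qA := ENNReal.ofReal qA) (A := A)
            (hA.imp (fun h => ⟨h.1, by rw [h.2]⟩) (fun h => ⟨h.1, by rw [h.2]; simp⟩)) h3,
          pow_natCount_eq (qA := ENNReal.ofReal qC) (A := C)
            (hC2.imp (fun h => ⟨h.1, by rw [h.2]⟩) (fun h => ⟨h.1, by rw [h.2]; simp⟩)) h4]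
        simp only [φ, B, Matrix.cons_val_zero, Matrix.cons_val_one, Matrix.cons_val, e1, e2,
          natCount]
        ring
    _ = _ := hprod
    _ = _ := by
        have i0 := hlaw hAm hA' fun k => (k : ℝ≥0∞) * ENNReal.ofReal qA ^ k
        have i1 := hlaw hCm hC' fun k => (k : ℝ≥0∞) * ENNReal.ofReal qC ^ k
        have i2 := hlaw hFm hF' fun k => ENNReal.ofReal q ^ k
        rw [lintegral_mul_pow_poissonMeasure _ hqA] at i0
        rw [lintegral_mul_pow_poissonMeasure _ hqC] at i1
        rw [lintegral_pow_poissonMeasure _ hq] at i2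
        have hr : ∀ {S : Set Plane}, volume S < ∞ →
            (((ENNReal.ofReal lam * volume S).toNNReal : ℝ≥0) : ℝ) = lam * volume.real S := by
          intro S hS
          rw [ENNReal.coe_toNNReal_eq_toReal, ENNReal.toReal_mul, ENNReal.toReal_ofReal hlam]
          rfl
        have hr' : ∀ {S : Set Plane}, volume S < ∞ →
            (((ENNReal.ofReal lam * volume S).toNNReal : ℝ≥0) : ℝ≥0∞) =
              ENNReal.ofReal lam * volume S := by
          intro S hS
          exact ENNReal.coe_toNNReal (ENNReal.mul_ne_top ENNReal.ofReal_ne_top hS.ne)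
        rw [hr hA', hr' hA'] at i0
        rw [hr hC', hr' hC'] at i1
        rw [hr hF'] at i2
        have hexp : Real.exp (-(lam * (1 - q) * volume.real D)) =
            Real.exp (-(lam * volume.real A * (1 - qA))) *
            Real.exp (-(lam * volume.real C * (1 - qC))) *
            Real.exp (-(lam * volume.real ((D \ A) \ C) * (1 - q))) := by
          rw [← Real.exp_add, ← Real.exp_add, mul_assoc, hsum]
          ring_nf
        rw [hexp, ENNReal.ofReal_mul (by positivity), ENNReal.ofReal_mul (by positivity)]
        refine (congr_arg₂ _ (congr_arg₂ _ i0 i1) i2).trans ?_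
        ring

/-- Two measures agree once they agree, finitely, on the intersections of all measurable rectangles
with the members of a countable cover. The diagonal is null for both, and off it the cover can be
chosen so that the independence computation applies. -/
theorem weightedPairs_pow_natCount [IsProbabilityMeasure μ] (hX : IsPoissonProcess μ lam X)
    (hlam : 0 ≤ lam) {q : ℝ} (hq : 0 ≤ q) {D : Set Plane} (hDm : MeasurableSet D)
    (hD' : volume D < ∞) :
    weightedPairs μ X (fun ω => ENNReal.ofReal q ^ natCount X D ω) =
      (volume : Measure (Plane × Plane)).withDensity (pairDensity lam q D) := by
  have hw : Measurable fun ω => ENNReal.ofReal q ^ natCount X D ω :=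
    (measurable_of_countable fun k : ℕ => ENNReal.ofReal q ^ k).comp
      (measurable_natCount hX.measurable hDm)
  have rect : ∀ {qA qC : ℝ} {A C : Set Plane}, MeasurableSet A → MeasurableSet C →
      volume A < ∞ → volume C < ∞ → Disjoint A C →
      (A ⊆ D ∧ qA = q ∨ Disjoint A D ∧ qA = 1) → (C ⊆ D ∧ qC = q ∨ Disjoint C D ∧ qC = 1) →
      weightedPairs μ X (fun ω => ENNReal.ofReal q ^ natCount X D ω) (A ×ˢ C) =
        (volume : Measure (Plane × Plane)).withDensity (pairDensity lam q D) (A ×ˢ C) ∧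
      weightedPairs μ X (fun ω => ENNReal.ofReal q ^ natCount X D ω) (A ×ˢ C) ≠ ∞ := by
    intro qA qC A C hAm hCm hA' hC' hAC hA hC
    rw [withDensity_pairDensity_prod hAm hCm hA hC, weightedPairs_prod hX.measurable hw hAm hCm hAC,
      lintegral_pow_mul_count_mul_count hX hlam hq hAm hCm hDm hA' hC' hD' hAC hA hC]
    refine ⟨rfl, ?_⟩
    have := hA'.ne
    have := hC'.ne
    finiteness
  have diag : (volume : Measure (Plane × Plane)).withDensity (pairDensity lam q D)
      (Set.diagonal Plane) = 0 := by
    exact withDensity_absolutelyContinuous _ _ volume_diagonal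
  let I : Type := {p : Set Plane × Set Plane // p.1 ∈ TopologicalSpace.countableBasis Plane ∧
    p.2 ∈ TopologicalSpace.countableBasis Plane ∧ Disjoint p.1 p.2}
  have hI : Countable I := by
    have : ({p : Set Plane × Set Plane | p.1 ∈ TopologicalSpace.countableBasis Plane ∧
      p.2 ∈ TopologicalSpace.countableBasis Plane ∧ Disjoint p.1 p.2}).Countable :=
      ((TopologicalSpace.countable_countableBasis Plane).prod
        (TopologicalSpace.countable_countableBasis Plane)).mono fun p hp =>
          Set.mk_mem_prod hp.1 hp.2.1
    exact this.to_subtype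
  let E : Bool → Set Plane := fun b => if b then D else Dᶜ
  -- `none` is the diagonal. Elsewhere disjoint basic open sets separate the coordinates, the ball
  -- makes volumes finite, and `E` puts each factor inside or outside `D`.
  let R : Option (I × ℕ × Bool × Bool) → Set (Plane × Plane) := fun o => o.elim
    (Set.diagonal Plane) fun t => (t.1.1.1 ∩ Metric.ball 0 t.2.1 ∩ E t.2.2.1) ×ˢ
      (t.1.1.2 ∩ Metric.ball 0 t.2.1 ∩ E t.2.2.2)
  have hEm : ∀ b, MeasurableSet (E b) := by
    intro b; cases b
    · exact hDm.compl
    · exact hDm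
  have hE : ∀ b (S : Set Plane), S ∩ E b ⊆ D ∧ (if b then q else 1) = q ∨
      Disjoint (S ∩ E b) D ∧ (if b then q else 1) = 1 := by
    intro b S; cases b
    · exact Or.inr ⟨Set.disjoint_left.2 fun x hx hx' => hx.2 hx', rfl⟩
    · exact Or.inl ⟨Set.inter_subset_right, rfl⟩
  have hgood : ∀ o, ∀ s ∈ Set.image2 (fun (s t : Set Plane) => s ×ˢ t)
      {s | MeasurableSet s} {t | MeasurableSet t},
      weightedPairs μ X (fun ω => ENNReal.ofReal q ^ natCount X D ω) (s ∩ R o) =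
        (volume : Measure (Plane × Plane)).withDensity (pairDensity lam q D) (s ∩ R o) ∧
      weightedPairs μ X (fun ω => ENNReal.ofReal q ^ natCount X D ω) (s ∩ R o) ≠ ∞ := by
    rintro o _ ⟨s, hs, t, ht, rfl⟩
    cases o with
    | none =>
      have h1 := measure_mono_null (Set.inter_subset_right (s := s ×ˢ t))
        (weightedPairs_diagonal hX (w := fun ω => ENNReal.ofReal q ^ natCount X D ω))
      have h2 := measure_mono_null (Set.inter_subset_right (s := s ×ˢ t)) diag
      exact ⟨h1.trans h2.symm, h1 ▸ ENNReal.zero_ne_top⟩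
    | some o =>
      obtain ⟨⟨⟨S, T⟩, hS, hT, hST⟩, n, b, c⟩ := o
      have hSm := (TopologicalSpace.isOpen_of_mem_countableBasis hS).measurableSet
      have hTm := (TopologicalSpace.isOpen_of_mem_countableBasis hT).measurableSet
      replace hs : MeasurableSet s := hs
      replace ht : MeasurableSet t := ht
      simp only [R, Option.elim, Set.prod_inter_prod, ← Set.inter_assoc]
      refine rect (qA := if b then q else 1) (qC := if c then q else 1) ?_ ?_ ?_ ?_ ?_ (hE _ _)
        (hE _ _)
      · exact ((hs.inter hSm).inter measurableSet_ball).inter (hEm _)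
      · exact ((ht.inter hTm).inter measurableSet_ball).inter (hEm _)
      · exact (measure_mono (Set.inter_subset_left.trans Set.inter_subset_right)).trans_lt
          measure_ball_lt_top
      · exact (measure_mono (Set.inter_subset_left.trans Set.inter_subset_right)).trans_lt
          measure_ball_lt_top
      · exact hST.mono (fun x hx => hx.1.1.2) (fun x hx => hx.1.1.2)
  have huniv : (Set.univ : Set (Plane × Plane)) ∈ Set.image2 (fun (s t : Set Plane) => s ×ˢ t)
      {s | MeasurableSet s} {t | MeasurableSet t} :=
    ⟨Set.univ, MeasurableSet.univ (α := Plane), Set.univ, MeasurableSet.univ (α := Plane),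
      Set.univ_prod_univ⟩
  refine Measure.ext_of_generateFrom_of_cover generateFrom_prod.symm (Set.countable_range R)
    isPiSystem_prod ?_ ?_ ?_ ?_
  · refine Set.eq_univ_of_forall fun ⟨x, y⟩ => ?_
    rcases eq_or_ne x y with rfl | hxy
    · exact ⟨_, ⟨none, rfl⟩, rfl⟩
    · obtain ⟨u, v, hu, hv, hxu, hyv, huv⟩ := t2_separation hxy
      have hb := TopologicalSpace.isBasis_countableBasis Plane
      obtain ⟨S, hS, hxS, hSu⟩ := hb.exists_subset_of_mem_open hxu hu
      obtain ⟨T, hT, hyT, hTv⟩ := hb.exists_subset_of_mem_open hyv hv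
      obtain ⟨n, hn⟩ := exists_nat_gt (max ‖x‖ ‖y‖)
      have hxE : ∀ x, ∃ b, x ∈ E b := fun x => by
        by_cases h : x ∈ D
        · exact ⟨true, h⟩
        · exact ⟨false, h⟩
      obtain ⟨b, hb⟩ := hxE x
      obtain ⟨c, hc⟩ := hxE y
      refine ⟨_, ⟨some ⟨⟨⟨S, T⟩, hS, hT, huv.mono hSu hTv⟩, n, b, c⟩, rfl⟩, ?_⟩
      refine ⟨⟨⟨hxS, ?_⟩, hb⟩, ⟨⟨hyT, ?_⟩, hc⟩⟩
      · simpa using (le_max_left _ _).trans_lt hn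
      · simpa using (le_max_right _ _).trans_lt hn
  · rintro _ ⟨o, rfl⟩
    simpa using (hgood o _ huniv).2
  · rintro _ ⟨o, rfl⟩ s hs
    exact (hgood o s hs).1
  · rintro _ ⟨o, rfl⟩
    simpa using (hgood o _ huniv).1

end Count

/-! ### The pair formula for a ball determined by the pair. -/

open Filter Topology

/-- Rounding to the first ε-close member of a dense sequence is measurable and takes countably many
values. -/
lemma exists_measurable_countable_approx {ε : ℝ} (hε : 0 < ε) :
    ∃ i : Plane → ℕ, Measurable i ∧ ∀ x, dist x (TopologicalSpace.denseSeq Plane (i x)) < ε := by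
  classical
  have h : ∀ x : Plane, ∃ n, dist x (TopologicalSpace.denseSeq Plane n) < ε := by
    intro x
    exact (TopologicalSpace.denseRange_denseSeq Plane).exists_dist_lt x hε
  refine ⟨fun x => Nat.find (h x), measurable_find h fun n => ?_, fun x => Nat.find_spec (h x)⟩
  exact measurableSet_lt (by fun_prop) measurable_const

section Count

variable {Ω : Type*} {X : ℕ → Ω → Plane} [MeasurableSpace Ω] {μ : Measure Ω} {lam : ℝ}

lemma measurable_pow_natCount (hX : ∀ n, Measurable (X n)) {D : Set Plane} (hD : MeasurableSet D)
    (q : ℝ≥0∞) : Measurable fun ω => q ^ natCount X D ω :=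
  (measurable_of_countable fun k : ℕ => q ^ k).comp (measurable_natCount hX hD)

lemma measurable_pow_natCount_random {D : Ω → Set Plane}
    (hD : ∀ n, MeasurableSet {ω | X n ω ∈ D ω}) (q : ℝ≥0∞) :
    Measurable fun ω => q ^ natCount X (D ω) ω :=
  (measurable_of_countable fun k : ℕ∞ => q ^ k.toNat).comp (measurable_count_random hD)

lemma measurable_pow_natCount_ball (hX : ∀ n, Measurable (X n)) {y : Ω → Plane} {r : Ω → ℝ}
    (hy : Measurable y) (hr : Measurable r) (q : ℝ≥0∞) :
    Measurable fun ω => q ^ natCount X (Metric.ball (y ω) (r ω)) ω :=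
  measurable_pow_natCount_random (fun n => by
    simp only [Metric.mem_ball]
    exact measurableSet_lt ((hX n).dist hy) hr) q

/-- The pair formula for a set depending on the two points through countably many values. -/
lemma tsum_lintegral_pow_natCount_countable [IsProbabilityMeasure μ]
    (hX : IsPoissonProcess μ lam X) (hlam : 0 ≤ lam) {q : ℝ} (hq : 0 ≤ q)
    {i : Plane → ℕ} (hi : Measurable i) {E : ℕ → ℕ → Set Plane}
    (hE : ∀ a b, MeasurableSet (E a b)) (hE' : ∀ a b, volume (E a b) < ∞)
    {f : Plane × Plane → ℝ≥0∞} (hf : Measurable f) :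
    ∑' p : {p : ℕ × ℕ // p.1 ≠ p.2}, ∫⁻ ω, ENNReal.ofReal q ^
        natCount X (E (i (X p.1.1 ω)) (i (X p.1.2 ω))) ω * f (X p.1.1 ω, X p.1.2 ω) ∂μ =
      ∫⁻ z, pairDensity lam q (E (i z.1) (i z.2)) z * f z := by
  -- Where both indices are frozen at `c`, the set is deterministic and the fixed-set formula
  -- applies.
  let g : ℕ × ℕ → Plane × Plane → ℝ≥0∞ := fun c => {z | (i z.1, i z.2) = c}.indicator f
  have hg : ∀ c, Measurable (g c) := fun c =>
    hf.indicator (((hi.comp measurable_fst).prodMk (hi.comp measurable_snd))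
      (measurableSet_singleton c))
  have hsum : ∀ (W : ℕ × ℕ → ℝ≥0∞) (z : Plane × Plane),
      W (i z.1, i z.2) * f z = ∑' c, W c * g c z := by
    intro W z
    rw [tsum_eq_single (i z.1, i z.2)]
    · simp [g]
    · intro c hc
      simp [g, Ne.symm hc]
  have hpw := fun a b => measurable_pow_natCount hX.measurable (hE a b) (ENNReal.ofReal q)
  calc _ = ∑' p : {p : ℕ × ℕ // p.1 ≠ p.2}, ∑' c : ℕ × ℕ, ∫⁻ ω, ENNReal.ofReal q ^
        natCount X (E c.1 c.2) ω * g c (X p.1.1 ω, X p.1.2 ω) ∂μ := by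
        refine tsum_congr fun p => ?_
        rw [← lintegral_tsum]
        · refine lintegral_congr fun ω => ?_
          exact hsum (fun c => ENNReal.ofReal q ^ natCount X (E c.1 c.2) ω) (X p.1.1 ω, X p.1.2 ω)
        · intro c
          exact ((hpw _ _).mul ((hg c).comp
            ((hX.measurable _).prodMk (hX.measurable _)))).aemeasurable
    _ = ∑' c : ℕ × ℕ, ∫⁻ z, g c z ∂(weightedPairs μ X
          fun ω => ENNReal.ofReal q ^ natCount X (E c.1 c.2) ω) := by
        rw [ENNReal.tsum_comm]
        refine tsum_congr fun c => ?_
        rw [lintegral_weightedPairs hX.measurable (hpw _ _) (hg c)]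
    _ = ∑' c : ℕ × ℕ, ∫⁻ z, pairDensity lam q (E c.1 c.2) z * g c z := by
        refine tsum_congr fun c => ?_
        rw [weightedPairs_pow_natCount hX hlam hq (hE _ _) (hE' _ _)]
        exact lintegral_withDensity_eq_lintegral_mul _ (measurable_pairDensity (hE _ _)) (hg c)
    _ = _ := by
        rw [← lintegral_tsum]
        · refine lintegral_congr fun z => ?_
          exact (hsum (fun c => pairDensity lam q (E c.1 c.2) z) z).symm
        · intro c
          exact ((measurable_pairDensity (hE _ _)).mul (hg c)).aemeasurable

lemma measurable_of_countable_param {ι β : Type*} [Countable ι] [MeasurableSpace ι]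
    [MeasurableSingletonClass ι] [MeasurableSpace β] {a : β → ι} (ha : Measurable a)
    {F : ι → β → ℝ≥0∞} (hF : ∀ i, Measurable (F i)) : Measurable fun z => F (a z) z := by
  have h : Measurable fun t : ι × β => F t.1 t.2 := measurable_from_prod_countable_right hF
  exact h.comp (ha.prodMk measurable_id)

lemma measurable_pairDensity_countable {lam q : ℝ} {a b : Plane × Plane → ℕ} (ha : Measurable a)
    (hb : Measurable b) {E : ℕ → ℕ → Set Plane} (hE : ∀ a b, MeasurableSet (E a b)) :
    Measurable fun z => pairDensity lam q (E (a z) (b z)) z :=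
  measurable_of_countable_param (F := fun c : ℕ × ℕ => pairDensity lam q (E c.1 c.2))
    (ha.prodMk hb) fun c => measurable_pairDensity (hE c.1 c.2)

lemma volumeReal_ball (x : Plane) (r : ℝ) :
    volume.real (Metric.ball x r) = max r 0 ^ 2 * Real.pi := by
  rw [measureReal_def, EuclideanSpace.volume_ball_fin_two, ENNReal.toReal_mul, ENNReal.toReal_pow,
    ENNReal.toReal_ofReal Real.pi_pos.le, ENNReal.toReal_ofReal']

lemma pairDensity_le (hlam : 0 ≤ lam) {q : ℝ} (hq1 : q ≤ 1) (D : Set Plane) (z : Plane × Plane) :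
    pairDensity lam q D z ≤ ENNReal.ofReal lam ^ 2 := by
  have h : ∀ x : Plane, D.indicator (fun _ => ENNReal.ofReal q) x +
      Dᶜ.indicator (1 : Plane → ℝ≥0∞) x ≤ 1 := by
    intro x
    by_cases hx : x ∈ D <;> simp [hx, hq1]
  have he : ENNReal.ofReal (Real.exp (-(lam * (1 - q) * volume.real D))) ≤ 1 := by
    rw [ENNReal.ofReal_le_one, Real.exp_le_one_iff, neg_nonpos]
    have := sub_nonneg.2 hq1
    positivity
  calc pairDensity lam q D z ≤ ENNReal.ofReal lam ^ 2 * 1 * (1 * 1) := by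
        unfold pairDensity
        gcongr
        · exact h _
        · exact h _
    _ = _ := by simp

/-- One null set serves all balls, since each lies in a centred ball of integer radius. This permits
random balls. -/
lemma ae_forall_count_ball_ne_top [IsProbabilityMeasure μ] (hX : IsPoissonProcess μ lam X) :
    ∀ᵐ ω ∂μ, ∀ (x : Plane) (r : ℝ), count X (Metric.ball x r) ω ≠ ⊤ := by
  have h : ∀ᵐ ω ∂μ, ∀ n : ℕ, count X (Metric.ball 0 n) ω ≠ ⊤ := ae_all_iff.2 fun n =>
    hX.ae_count_ne_top measurableSet_ball measure_ball_lt_top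
  filter_upwards [h] with ω hω x r
  obtain ⟨n, hn⟩ := exists_nat_gt (‖x‖ + r)
  refine ne_top_of_le_ne_top (hω n) (Set.encard_le_encard fun k hk => ?_)
  refine Metric.ball_subset_ball' ?_ hk
  rw [dist_zero_right]
  linarith

/-- Almost surely the limit ball holds finitely many points, so the approximating balls eventually
hold the same ones and the weight becomes constant. Dominated convergence by `f` is used twice, for
the expectation and for the sum over pairs. -/
lemma tendsto_tsum_lintegral_pow_natCount [IsProbabilityMeasure μ]
    (hX : IsPoissonProcess μ lam X) {q : ℝ} (hq1 : q ≤ 1)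
    {f : Plane × Plane → ℝ≥0∞} (hf : Measurable f)
    (hfin : ∑' p : {p : ℕ × ℕ // p.1 ≠ p.2}, ∫⁻ ω, f (X p.1.1 ω, X p.1.2 ω) ∂μ ≠ ∞)
    {c : ℕ → Plane × Plane → Plane} {ρ : ℕ → Plane × Plane → ℝ} (hc : ∀ j, Measurable (c j))
    (hρ : ∀ j, Measurable (ρ j))
    (hsub : ∀ j z, Metric.ball (c j z) (ρ j z) ⊆ Metric.ball z.2 (dist z.1 z.2))
    (hmem : ∀ z, ∀ u ∈ Metric.ball z.2 (dist z.1 z.2), ∀ᶠ j in atTop,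
      u ∈ Metric.ball (c j z) (ρ j z)) :
    Tendsto (fun j => ∑' p : {p : ℕ × ℕ // p.1 ≠ p.2}, ∫⁻ ω, ENNReal.ofReal q ^
        natCount X (Metric.ball (c j (X p.1.1 ω, X p.1.2 ω)) (ρ j (X p.1.1 ω, X p.1.2 ω))) ω *
          f (X p.1.1 ω, X p.1.2 ω) ∂μ)
      atTop (𝓝 (∑' p : {p : ℕ × ℕ // p.1 ≠ p.2}, ∫⁻ ω, ENNReal.ofReal q ^
        natCount X (Metric.ball (X p.1.2 ω) (dist (X p.1.1 ω) (X p.1.2 ω))) ω *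
          f (X p.1.1 ω, X p.1.2 ω) ∂μ)) := by
  have hpow1 : ∀ k : ℕ, ENNReal.ofReal q ^ k ≤ 1 := fun k =>
    pow_le_one₀ zero_le (by simpa using hq1)
  have hXX : ∀ p : {p : ℕ × ℕ // p.1 ≠ p.2}, Measurable fun ω => (X p.1.1 ω, X p.1.2 ω) :=
    fun p => (hX.measurable _).prodMk (hX.measurable _)
  -- The sum becomes an integral against counting measure, so that dominated convergence covers it.
  simp_rw [← lintegral_count]
  refine tendsto_lintegral_of_dominated_convergence
    (fun p : {p : ℕ × ℕ // p.1 ≠ p.2} => ∫⁻ ω, f (X p.1.1 ω, X p.1.2 ω) ∂μ)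
    (fun j => measurable_of_countable _) ?_ (by rwa [lintegral_count]) ?_
  · exact fun j => ae_of_all _ fun p => lintegral_mono fun ω =>
      mul_le_of_le_one_left zero_le (hpow1 _)
  · refine ae_of_all _ fun p => ?_
    refine tendsto_lintegral_of_dominated_convergence
      (fun ω => f (X p.1.1 ω, X p.1.2 ω)) (fun j => ?_) ?_ (ENNReal.ne_top_of_tsum_ne_top hfin p)
      ?_
    · exact (measurable_pow_natCount_ball hX.measurable ((hc j).comp (hXX p))
        ((hρ j).comp (hXX p)) _).mul (hf.comp (hXX p))
    · exact fun j => ae_of_all _ fun ω => mul_le_of_le_one_left zero_le (hpow1 _)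
    · filter_upwards [ae_forall_count_ball_ne_top hX] with ω hω
      refine tendsto_const_nhds.congr' ?_
      have hfinite : {k | X k ω ∈ Metric.ball (X p.1.2 ω) (dist (X p.1.1 ω) (X p.1.2 ω))}.Finite :=
        Set.encard_ne_top_iff.1 (hω (X p.1.2 ω) (dist (X p.1.1 ω) (X p.1.2 ω)))
      filter_upwards [(eventually_all_finite hfinite).2 fun k hk =>
        hmem (X p.1.1 ω, X p.1.2 ω) (X k ω) hk] with j hj
      have e : {k | X k ω ∈ Metric.ball (X p.1.2 ω) (dist (X p.1.1 ω) (X p.1.2 ω))} =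
          {k | X k ω ∈ Metric.ball (c j (X p.1.1 ω, X p.1.2 ω)) (ρ j (X p.1.1 ω, X p.1.2 ω))} :=
        Set.Subset.antisymm hj fun k hk => hsub j (X p.1.1 ω, X p.1.2 ω) hk
      rw [natCount, natCount, count, count, e]

lemma ae_fst_ne_snd : ∀ᵐ z : Plane × Plane, z.1 ≠ z.2 :=
  measure_mono_null (fun _ hz => not_not.1 hz) volume_diagonal

/-- The point x, on the boundary of the open limit ball, is in no approximating ball, while y
eventually is: exactly one factor q remains. -/
lemma tendsto_pairDensity_ball {q : ℝ} {x y : Plane} (hxy : x ≠ y)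
    {c : ℕ → Plane} {ρ : ℕ → ℝ} (hρ : Tendsto ρ atTop (𝓝 (dist x y)))
    (hsub : ∀ j, Metric.ball (c j) (ρ j) ⊆ Metric.ball y (dist x y))
    (hmem : ∀ u ∈ Metric.ball y (dist x y), ∀ᶠ j in atTop, u ∈ Metric.ball (c j) (ρ j)) :
    Tendsto (fun j => pairDensity lam q (Metric.ball (c j) (ρ j)) (x, y)) atTop
      (𝓝 (ENNReal.ofReal lam ^ 2 *
        ENNReal.ofReal (Real.exp (-(lam * (1 - q) * (dist x y ^ 2 * Real.pi)))) *
          ENNReal.ofReal q)) := by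
  have h1 : Tendsto (fun j => ENNReal.ofReal lam ^ 2 *
      ENNReal.ofReal (Real.exp (-(lam * (1 - q) * (max (ρ j) 0 ^ 2 * Real.pi)))) *
        ENNReal.ofReal q) atTop (𝓝 (ENNReal.ofReal lam ^ 2 *
        ENNReal.ofReal (Real.exp (-(lam * (1 - q) * (dist x y ^ 2 * Real.pi)))) *
          ENNReal.ofReal q)) := by
    have h2 : Tendsto (fun j => max (ρ j) 0) atTop (𝓝 (dist x y)) := by
      simpa using hρ.max (tendsto_const_nhds (x := (0 : ℝ)))
    have h3 : Continuous fun r : ℝ => Real.exp (-(lam * (1 - q) * (r ^ 2 * Real.pi))) := by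
      fun_prop
    refine ENNReal.Tendsto.mul_const (ENNReal.Tendsto.const_mul
      (ENNReal.tendsto_ofReal ((h3.tendsto _).comp h2)) (Or.inr (by finiteness)))
      (Or.inr ENNReal.ofReal_ne_top)
  refine h1.congr' ?_
  filter_upwards [hmem y (Metric.mem_ball_self (dist_pos.2 hxy))] with j hj
  have hx : x ∉ Metric.ball (c j) (ρ j) := fun h => lt_irrefl _ (Metric.mem_ball.1 (hsub j h))
  rw [pairDensity, volumeReal_ball]
  simp [hx, hj]

/-- Balls depending on two points through countably many values, which exhaust from inside the
open ball around the second point with the first point on its boundary. -/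
lemma exists_countable_ball_approx : ∃ (i : ℕ → Plane → ℕ) (d : ℕ → Plane) (r : ℕ → ℕ → ℕ → ℝ),
    (∀ j, Measurable (i j)) ∧
    (∀ j x y, Metric.ball (d (i j y)) (r j (i j x) (i j y)) ⊆ Metric.ball y (dist x y)) ∧
    (∀ x y, ∀ z ∈ Metric.ball y (dist x y), ∀ᶠ j in atTop,
      z ∈ Metric.ball (d (i j y)) (r j (i j x) (i j y))) ∧
    ∀ x y, Tendsto (fun j => r j (i j x) (i j y)) atTop (𝓝 (dist x y)) := by
  let ε : ℕ → ℝ := fun j => 1 / ((j : ℝ) + 1)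
  have hε : ∀ j, 0 < ε j := fun j => by positivity
  have hε0 : Tendsto ε atTop (𝓝 0) := tendsto_one_div_add_atTop_nhds_zero_nat
  choose i him hi using fun j => exists_measurable_countable_approx (hε j)
  let d := TopologicalSpace.denseSeq Plane
  let s : ℕ → Plane → Plane := fun j x => d (i j x)
  have hs : ∀ j x, dist x (s j x) < ε j := hi
  -- Rounding changes the distance of the pair by at most 2ε and moves the centre by at most ε;
  -- shrinking by 3ε keeps the ball inside.
  refine ⟨i, d, fun j a b => dist (d a) (d b) - 3 * ε j, him, ?_, ?_, ?_⟩
  · intro j x y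
    refine Metric.ball_subset_ball' ?_
    have h1 := hs j x
    have h2 := hs j y
    have h3 := dist_triangle4 (s j x) x y (s j y)
    rw [dist_comm] at h1
    have h4 := dist_comm (s j y) y
    change dist (s j x) (s j y) - 3 * ε j + dist (s j y) y ≤ dist x y
    linarith
  · intro x y z hz
    -- The 6 counts the 3ε of rounding error and the 3ε of shrinking.
    have : 0 < (dist x y - dist z y) / 6 := by
      have : dist z y < dist x y := hz
      linarith
    filter_upwards [hε0.eventually (gt_mem_nhds this)] with j hj
    change dist z (s j y) < dist (s j x) (s j y) - 3 * ε j
    have h1 := hs j x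
    have h2 := hs j y
    have h3 := dist_triangle4 x (s j x) (s j y) y
    have h4 := dist_triangle z y (s j y)
    have h5 := dist_comm (s j y) y
    linarith
  · have hsx : ∀ x, Tendsto (fun j => s j x) atTop (𝓝 x) := fun x => by
      rw [tendsto_iff_dist_tendsto_zero]
      refine squeeze_zero (fun _ => dist_nonneg) (fun j => ?_) hε0
      rw [dist_comm]
      exact (hs j x).le
    intro x y
    simpa using ((hsx x).dist (hsx y)).sub (hε0.const_mul 3)

/-- The pair formula for the ball centred at the second point with the first point on its
boundary. -/
theorem tsum_lintegral_pow_natCount_ball_of_ne_top [IsProbabilityMeasure μ]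
    (hX : IsPoissonProcess μ lam X) (hlam : 0 ≤ lam) {q : ℝ} (hq : 0 ≤ q) (hq1 : q ≤ 1)
    {f : Plane × Plane → ℝ≥0∞} (hf : Measurable f) (hf' : ∫⁻ z, f z ≠ ∞) :
    ∑' p : {p : ℕ × ℕ // p.1 ≠ p.2}, ∫⁻ ω, ENNReal.ofReal q ^
        natCount X (Metric.ball (X p.1.2 ω) (dist (X p.1.1 ω) (X p.1.2 ω))) ω *
          f (X p.1.1 ω, X p.1.2 ω) ∂μ =
      ∫⁻ z : Plane × Plane, ENNReal.ofReal lam ^ 2 *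
        ENNReal.ofReal (Real.exp (-(lam * (1 - q) * (dist z.1 z.2 ^ 2 * Real.pi)))) *
          ENNReal.ofReal q * f z := by
  have hbound : ∫⁻ z, ENNReal.ofReal lam ^ 2 * f z ≠ ∞ := by
    rw [lintegral_const_mul _ hf]
    finiteness
  have hfin : ∑' p : {p : ℕ × ℕ // p.1 ≠ p.2}, ∫⁻ ω, f (X p.1.1 ω, X p.1.2 ω) ∂μ ≠ ∞ := by
    -- With the empty set the weight is 1, and the formula bounds the unweighted pair sum.
    have h := tsum_lintegral_pow_natCount_countable hX hlam hq (i := fun _ => 0)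
      measurable_const (E := fun _ _ => ∅) (fun _ _ => MeasurableSet.empty) (by simp) hf
    have h0 : ∀ ω, natCount X ∅ ω = 0 := by simp [natCount, count]
    simp only [h0, pow_zero, one_mul] at h
    rw [h]
    exact ne_top_of_le_ne_top hbound (lintegral_mono
      fun z => mul_le_mul_left (pairDensity_le hlam hq1 _ _) _)
  obtain ⟨i, d, r, him, hsub, hmem, hr⟩ := exists_countable_ball_approx
  have h1 : ∀ j, Measurable fun z : Plane × Plane => i j z.1 := fun j =>
    (him j).comp measurable_fst
  have h2 : ∀ j, Measurable fun z : Plane × Plane => i j z.2 := fun j =>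
    (him j).comp measurable_snd
  have hL := tendsto_tsum_lintegral_pow_natCount hX hq1 hf hfin
    (c := fun j z => d (i j z.2)) (ρ := fun j z => r j (i j z.1) (i j z.2))
    (fun j => (measurable_of_countable d).comp (h2 j))
    (fun j => (measurable_of_countable fun t : ℕ × ℕ => r j t.1 t.2).comp ((h1 j).prodMk (h2 j)))
    (fun j z => hsub j z.1 z.2) (fun z => hmem z.1 z.2)
  have hR : Tendsto (fun j => ∫⁻ z, pairDensity lam q
      (Metric.ball (d (i j z.2)) (r j (i j z.1) (i j z.2))) z * f z) atTop
      (𝓝 (∫⁻ z : Plane × Plane, ENNReal.ofReal lam ^ 2 *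
        ENNReal.ofReal (Real.exp (-(lam * (1 - q) * (dist z.1 z.2 ^ 2 * Real.pi)))) *
          ENNReal.ofReal q * f z)) := by
    refine tendsto_lintegral_of_dominated_convergence (fun z => ENNReal.ofReal lam ^ 2 * f z)
      (fun j => ?_) ?_ hbound ?_
    · exact (measurable_pairDensity_countable (h1 j) (h2 j)
        (E := fun a b => Metric.ball (d b) (r j a b)) fun _ _ => measurableSet_ball).mul hf
    · exact fun j => ae_of_all _ fun z => mul_le_mul_left (pairDensity_le hlam hq1 _ _) _
    · have hft := ae_lt_top hf hf'
      filter_upwards [ae_fst_ne_snd, hft] with z hz hz'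
      exact ENNReal.Tendsto.mul_const (tendsto_pairDensity_ball hz (hr z.1 z.2)
        (fun j => hsub j z.1 z.2) (hmem z.1 z.2)) (Or.inr hz'.ne)
  exact tendsto_nhds_unique (hL.congr fun j => tsum_lintegral_pow_natCount_countable hX hlam hq
    (him j) (E := fun a b => Metric.ball (d b) (r j a b))
    (fun _ _ => measurableSet_ball) (fun _ _ => measure_ball_lt_top) hf) hR

end Count

/-- Integrability of `f` is replaced by boundedness, because the received power is not integrable
over the plane when α ≤ 2. A bounded `f` is a countable sum of integrable pieces, supported on sets
of finite volume. -/
theorem tsum_lintegral_pow_natCount_ball {Ω : Type*} [MeasurableSpace Ω] {μ : Measure Ω}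
    [IsProbabilityMeasure μ] {X : ℕ → Ω → Plane} {lam : ℝ}
    (hX : IsPoissonProcess μ lam X) (hlam : 0 ≤ lam) {q : ℝ} (hq : 0 ≤ q) (hq1 : q ≤ 1)
    {f : Plane × Plane → ℝ≥0∞} (hf : Measurable f) {C : ℝ≥0∞} (hC : C ≠ ∞) (hfC : ∀ z, f z ≤ C) :
    ∑' p : {p : ℕ × ℕ // p.1 ≠ p.2}, ∫⁻ ω, ENNReal.ofReal q ^
        natCount X (Metric.ball (X p.1.2 ω) (dist (X p.1.1 ω) (X p.1.2 ω))) ω *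
          f (X p.1.1 ω, X p.1.2 ω) ∂μ =
      ∫⁻ z : Plane × Plane, ENNReal.ofReal lam ^ 2 *
        ENNReal.ofReal (Real.exp (-(lam * (1 - q) * (dist z.1 z.2 ^ 2 * Real.pi)))) *
          ENNReal.ofReal q * f z := by
  let ι : Plane × Plane → ℕ := spanningSetsIndex volume
  let g : ℕ → Plane × Plane → ℝ≥0∞ := fun k => {z | ι z = k}.indicator f
  have hι : ∀ k, MeasurableSet {z | ι z = k} := fun k =>
    measurableSet_spanningSetsIndex volume (measurableSet_singleton k)
  have hg : ∀ k, Measurable (g k) := fun k => hf.indicator (hι k)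
  have hg' : ∀ k, ∫⁻ z, g k z ≠ ∞ := by
    intro k
    have h1 : ∫⁻ z, g k z ≤ ∫⁻ z in {z | ι z = k}, C := by
      rw [lintegral_indicator (hι k)]
      exact lintegral_mono hfC
    have h2 : volume {z | ι z = k} < ∞ := by
      refine (measure_mono fun z (hz : ι z = k) => ?_).trans_lt
        (measure_spanningSets_lt_top volume k)
      exact hz ▸ mem_spanningSetsIndex volume z
    rw [setLIntegral_const] at h1
    exact ne_top_of_le_ne_top (ENNReal.mul_ne_top hC h2.ne) h1
  have hsum : ∀ (c : ℝ≥0∞) z, c * f z = ∑' k, c * g k z := by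
    intro c z
    rw [tsum_eq_single (ι z)]
    · simp [g]
    · intro k hk
      simp [g, Ne.symm hk]
  have hXX : ∀ p : {p : ℕ × ℕ // p.1 ≠ p.2}, Measurable fun ω => (X p.1.1 ω, X p.1.2 ω) :=
    fun p => (hX.measurable _).prodMk (hX.measurable _)
  simp_rw [hsum]
  rw [lintegral_tsum]
  · rw [← tsum_congr fun k =>
      tsum_lintegral_pow_natCount_ball_of_ne_top hX hlam hq hq1 (hg k) (hg' k), ENNReal.tsum_comm]
    refine tsum_congr fun p => lintegral_tsum fun k => ?_
    exact ((measurable_pow_natCount_ball hX.measurable (hX.measurable _)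
      ((hX.measurable _).dist (hX.measurable _)) _).mul ((hg k).comp (hXX p))).aemeasurable
  · intro k
    refine (Measurable.mul ?_ (hg k)).aemeasurable
    fun_prop

/-! ### The deterministic integrals. -/

lemma lintegral_prod_indicator_mul_dist {B : Set Plane} (hB : MeasurableSet B) {g : ℝ → ℝ≥0∞}
    (hg : Measurable g) :
    ∫⁻ z : Plane × Plane, B.indicator 1 z.1 * g (dist z.1 z.2) =
      volume B * ∫⁻ y : Plane, g ‖y‖ := by
  rw [Measure.volume_eq_prod, lintegral_prod _ (by
    have : Measurable fun z : Plane × Plane => B.indicator (1 : Plane → ℝ≥0∞) z.1 :=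
      (measurable_one.indicator hB).comp measurable_fst
    exact (this.mul (hg.comp (by fun_prop))).aemeasurable)]
  have h : ∀ x : Plane, ∫⁻ y, B.indicator 1 x * g (dist x y) =
      B.indicator 1 x * ∫⁻ y : Plane, g ‖y‖ := by
    intro x
    have hm : Measurable fun y => g (dist x y) := hg.comp (by fun_prop)
    rw [lintegral_const_mul _ hm]
    congr 1
    simp_rw [dist_eq_norm]
    exact lintegral_sub_left_eq_self (fun y : Plane => g ‖y‖) x
  simp_rw [h]
  rw [lintegral_mul_const _ (measurable_one.indicator hB), lintegral_indicator_one hB]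

lemma integral_Ioc_mul_exp_neg_mul_sq {c : ℝ} (hc : 0 < c) {r : ℝ} (hr : 0 ≤ r) :
    ∫ t in Set.Ioc 0 r, t * Real.exp (-(c * t ^ 2)) = (1 - Real.exp (-(c * r ^ 2))) / (2 * c) := by
  rw [← intervalIntegral.integral_of_le hr,
    intervalIntegral.integral_eq_sub_of_hasDerivAt (f := fun t => -Real.exp (-(c * t ^ 2)) / (2 * c))]
  · simp; ring
  · intro t _
    have h := ((((hasDerivAt_pow 2 t).const_mul c).neg.exp).neg).div_const (2 * c)
    refine HasDerivAt.congr_deriv (f := fun t => -Real.exp (-(c * t ^ 2)) / (2 * c)) h ?_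
    simp only [Pi.neg_apply]
    push_cast
    field_simp
  · exact Continuous.intervalIntegrable (by fun_prop) _ _

/-- Substitute u = ct². As r > 0 the singularity at 0 is avoided, and the order 1 - α/2 may be
negative. -/
lemma integral_Ioi_mul_rpow_mul_exp_neg_mul_sq {c : ℝ} (hc : 0 < c) (α : ℝ) {r : ℝ} (hr : 0 < r) :
    ∫ t in Set.Ioi r, t * (t ^ (-α) * Real.exp (-(c * t ^ 2))) =
      upperIncompleteGamma (1 - α / 2) (c * r ^ 2) / (2 * c ^ (1 - α / 2)) := by
  have himg : (fun t : ℝ => c * t ^ 2) '' Set.Ioi r = Set.Ioi (c * r ^ 2) := by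
    ext u
    simp only [Set.mem_image, Set.mem_Ioi]
    constructor
    · rintro ⟨t, ht, rfl⟩
      gcongr
    · intro hu
      have hu' : r ^ 2 < u / c := by rw [lt_div_iff₀ hc]; linarith
      refine ⟨√(u / c), Real.lt_sqrt_of_sq_lt hu', ?_⟩
      rw [Real.sq_sqrt ((sq_nonneg r).trans hu'.le)]
      field_simp
  have hinj : Set.InjOn (fun t : ℝ => c * t ^ 2) (Set.Ioi r) := by
    intro a ha b hb hab
    have ha' : 0 < a := hr.trans ha
    have hb' : 0 < b := hr.trans hb
    have : a ^ 2 = b ^ 2 := mul_left_cancel₀ hc.ne' hab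
    exact (pow_left_inj₀ ha'.le hb'.le two_ne_zero).1 this
  have hder : ∀ t ∈ Set.Ioi r, HasDerivWithinAt (fun t : ℝ => c * t ^ 2) (c * (2 * t))
      (Set.Ioi r) t := by
    intro t _
    simpa using ((hasDerivAt_pow 2 t).const_mul c).hasDerivWithinAt
  rw [upperIncompleteGamma, ← himg,
    integral_image_eq_integral_abs_deriv_smul measurableSet_Ioi hder hinj, ← integral_div]
  refine setIntegral_congr_fun measurableSet_Ioi fun t ht => ?_
  have ht' : 0 < t := hr.trans ht
  have h1 : (c * t ^ 2) ^ (1 - α / 2 - 1) = c ^ (1 - α / 2) / c * t ^ (-α) := by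
    rw [Real.mul_rpow hc.le (by positivity), ← Real.rpow_natCast, ← Real.rpow_mul ht'.le,
      Real.rpow_sub_one hc.ne']
    congr 2
    push_cast
    ring
  have h2 : 0 < c ^ (1 - α / 2) := Real.rpow_pos_of_pos hc _
  simp only [smul_eq_mul]
  rw [h1, abs_of_pos (by positivity)]
  field_simp

/-- Positivity of `d` matters: for α > 0 the real power `0 ^ (-α)` is 0, whereas in `ℝ≥0∞` it is
`∞`. -/
lemma receivedPower_eq {Pmax PT α d : ℝ} (hPmax : 0 ≤ Pmax) (hd : 0 < d) :
    receivedPower Pmax PT α d = ENNReal.ofReal (min (Pmax * d ^ (-α)) PT) := by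
  rw [receivedPower, ENNReal.ofReal_rpow_of_pos hd, ← ENNReal.ofReal_mul hPmax, ENNReal.ofReal_min]

lemma measurable_receivedPower (Pmax PT α : ℝ) : Measurable (receivedPower Pmax PT α) := by
  unfold receivedPower
  fun_prop

lemma min_mul_rpow_neg {Pmax PT α : ℝ} (hPmax : 0 < Pmax) (hPT : 0 < PT) (hα : 0 < α) {d : ℝ}
    (hd : 0 < d) :
    min (Pmax * d ^ (-α)) PT =
      if d ≤ criticalDistance Pmax PT α then PT else Pmax * d ^ (-α) := by
  have hc : 0 < Pmax / PT := by positivity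
  have hp : 0 < d ^ α := Real.rpow_pos_of_pos hd _
  have key : d ≤ criticalDistance Pmax PT α ↔ PT ≤ Pmax * d ^ (-α) := by
    rw [criticalDistance, one_div, Real.le_rpow_inv_iff_of_pos hd.le hc.le hα, Real.rpow_neg hd.le,
      ← div_eq_mul_inv, le_div_iff₀ hPT, le_div_iff₀ hp, mul_comm]
  split_ifs with h
  · exact min_eq_right (key.1 h)
  · exact min_eq_left (not_le.1 (mt key.2 h)).le

/-- In polar coordinates the minimum is constant up to the critical distance and a pure power beyond
it. Integrability follows from the Gaussian bound PT · r · exp(-cr²). -/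
lemma lintegral_exp_mul_receivedPower {c Pmax PT α : ℝ} (hc : 0 < c) (hPmax : 0 < Pmax)
    (hPT : 0 < PT) (hα : 0 < α) :
    ∫⁻ y : Plane, ENNReal.ofReal (Real.exp (-(c * ‖y‖ ^ 2))) * receivedPower Pmax PT α ‖y‖ =
      ENNReal.ofReal (Real.pi *
        ((1 - Real.exp (-(c * criticalDistance Pmax PT α ^ 2))) / c * PT +
        Pmax * upperIncompleteGamma (1 - α / 2) (c * criticalDistance Pmax PT α ^ 2) /
          c ^ (1 - α / 2))) := by
  let g : ℝ → ℝ := fun r => Real.exp (-(c * r ^ 2)) * min (Pmax * r ^ (-α)) PT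
  have hrc : 0 < criticalDistance Pmax PT α := Real.rpow_pos_of_pos (by positivity) _
  have hgm : Measurable g := by fun_prop
  have hfr : Module.finrank ℝ Plane = 2 := by simp
  have hint : IntegrableOn (fun r : ℝ => r * g r) (Set.Ioi 0) := by
    have h := ((integrable_mul_exp_neg_mul_sq hc).const_mul PT).integrableOn (s := Set.Ioi (0 : ℝ))
    refine h.mono' (by fun_prop) ?_
    filter_upwards [ae_restrict_mem measurableSet_Ioi] with r (hr : 0 < r)
    have h0 : 0 ≤ min (Pmax * r ^ (-α)) PT := le_min (by positivity) hPT.le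
    have h1 : min (Pmax * r ^ (-α)) PT ≤ PT := min_le_right _ _
    rw [Real.norm_of_nonneg (by positivity), neg_mul]
    calc r * (Real.exp (-(c * r ^ 2)) * min (Pmax * r ^ (-α)) PT)
        ≤ r * (Real.exp (-(c * r ^ 2)) * PT) := by gcongr
      _ = _ := by ring
  have hgi : Integrable (fun y : Plane => g ‖y‖) := by
    rw [integrable_fun_norm_addHaar volume (f := g), hfr]
    simpa using hint
  have hg0 : ∀ y : Plane, 0 ≤ g ‖y‖ := fun y => by
    have h0 : 0 ≤ min (Pmax * ‖y‖ ^ (-α)) PT := le_min (by positivity) hPT.le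
    positivity
  calc _ = ∫⁻ y : Plane, ENNReal.ofReal (g ‖y‖) := by
        refine lintegral_congr_ae ?_
        have : ∀ᵐ y : Plane, y ≠ 0 := Measure.ae_ne volume 0
        filter_upwards [this] with y hy
        rw [receivedPower_eq hPmax.le (norm_pos_iff.2 hy), ← ENNReal.ofReal_mul (by positivity)]
    _ = ENNReal.ofReal (∫ y : Plane, g ‖y‖) :=
        (ofReal_integral_eq_lintegral_ofReal hgi (ae_of_all _ hg0)).symm
    _ = _ := by
        congr 1
        rw [integral_fun_norm_addHaar volume g, hfr, volumeReal_ball]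
        have hsplit : ∫ r in Set.Ioi (0 : ℝ), r * g r =
            PT * ((1 - Real.exp (-(c * criticalDistance Pmax PT α ^ 2))) / (2 * c)) +
            Pmax * (upperIncompleteGamma (1 - α / 2) (c * criticalDistance Pmax PT α ^ 2) /
              (2 * c ^ (1 - α / 2))) := by
          rw [← integral_Ioc_mul_exp_neg_mul_sq hc hrc.le,
            ← integral_Ioi_mul_rpow_mul_exp_neg_mul_sq hc α hrc, ← integral_const_mul,
            ← integral_const_mul, ← Set.Ioc_union_Ioi_eq_Ioi hrc.le,
            setIntegral_union (Set.Ioc_disjoint_Ioi le_rfl) measurableSet_Ioi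
              (hint.mono_set Set.Ioc_subset_Ioi_self)
              (hint.mono_set (Set.Ioi_subset_Ioi hrc.le))]
          congr 1
          · refine setIntegral_congr_fun measurableSet_Ioc fun r hr => ?_
            simp only [g]
            rw [min_mul_rpow_neg hPmax hPT hα hr.1, if_pos hr.2]
            ring
          · refine setIntegral_congr_fun measurableSet_Ioi fun r hr => ?_
            simp only [g]
            rw [min_mul_rpow_neg hPmax hPT hα (hrc.trans hr), if_neg (not_le.2 hr)]
            ring
        simp only [Nat.add_one_sub_one, pow_one, smul_eq_mul, nsmul_eq_mul]
        rw [hsplit]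
        norm_num
        field_simp

/-! ### Marks, Voronoi cells and the thinned process. -/

section Thinning

variable {Ω : Type*} {X : ℕ → Ω → Plane} {U : ℕ → Ω → Bool}

lemma aggregators_inter (B : Set Plane) (ω : Ω) :
    aggregators X U ω ∩ B = (fun n => X n ω) '' {n | U n ω = true ∧ X n ω ∈ B} := by
  ext x
  simp only [aggregators, pointsWithMark, Set.mem_inter_iff, Set.mem_ofPred_eq, Set.mem_image]
  constructor
  · rintro ⟨⟨n, h1, rfl⟩, h2⟩
    exact ⟨n, ⟨h1, h2⟩, rfl⟩
  · rintro ⟨n, ⟨h1, h2⟩, rfl⟩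
    exact ⟨⟨n, h1, rfl⟩, h2⟩

/-- The configurations of points and marks in which the point `n` is selected, and no point closer
to the point `m` than the point `n` is selected. -/
def nearestSelected (n m : ℕ) : Set ((ℕ → Plane) × (ℕ → Bool)) :=
  {c | c.2 n = true ∧ ∀ k, dist (c.1 k) (c.1 m) < dist (c.1 n) (c.1 m) → c.2 k = false}

/-- Reindexing by the points of the sequence: the sum over the pairs of an aggregator `x` in `B`
and a device in its Voronoi cell. -/
lemma tsum_totalReceivedPower {Pmax PT α : ℝ} (B : Set Plane) {ω : Ω}
    (hω : Function.Injective fun n => X n ω) :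
    ∑' x : ↥(aggregators X U ω ∩ B), totalReceivedPower Pmax PT α
        ((fun y => y - (x : Plane)) '' aggregators X U ω)
        ((fun y => y - (x : Plane)) '' devices X U ω) =
      ∑' p : {p : ℕ × ℕ // p.1 ≠ p.2},
        (nearestSelected p.1.1 p.1.2).indicator 1 (fun k => X k ω, fun k => U k ω) *
          (B.indicator 1 (X p.1.1 ω) *
            receivedPower Pmax PT α (dist (X p.1.1 ω) (X p.1.2 ω))) := by
  classical
  have e2 : ∀ n, ((fun y => y - X n ω) '' devices X U ω) ∩
      voronoiCell ((fun y => y - X n ω) '' aggregators X U ω) 0 =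
      (fun m => X m ω - X n ω) '' {m | U m ω = false ∧
        ∀ k, U k ω = true → dist (X n ω) (X m ω) ≤ dist (X k ω) (X m ω)} := by
    intro n
    have hcell : ∀ m, X m ω - X n ω ∈ voronoiCell ((fun y => y - X n ω) '' aggregators X U ω) 0 ↔
        ∀ k, U k ω = true → dist (X n ω) (X m ω) ≤ dist (X k ω) (X m ω) := by
      intro m
      simp only [voronoiCell, aggregators, pointsWithMark, Set.mem_ofPred_eq, Set.forall_mem_image,
        dist_sub_right, dist_zero_right, ← dist_eq_norm, dist_comm (X m ω)]
      constructor
      · intro h k hk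
        exact h ⟨k, hk, rfl⟩
      · rintro h _ ⟨k, hk, rfl⟩
        exact h k hk
    ext y
    constructor
    · rintro ⟨⟨_, ⟨m, hm, rfl⟩, rfl⟩, hy⟩
      exact ⟨m, ⟨hm, (hcell m).1 hy⟩, rfl⟩
    · rintro ⟨m, ⟨hm, hy⟩, rfl⟩
      exact ⟨⟨_, ⟨m, hm, rfl⟩, rfl⟩, (hcell m).2 hy⟩
  have e3 : ∀ n, totalReceivedPower Pmax PT α ((fun y => y - X n ω) '' aggregators X U ω)
      ((fun y => y - X n ω) '' devices X U ω) = ∑' m, if U m ω = false ∧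
        ∀ k, U k ω = true → dist (X n ω) (X m ω) ≤ dist (X k ω) (X m ω) then
          receivedPower Pmax PT α (dist (X n ω) (X m ω)) else 0 := by
    intro n
    have hinj : Function.Injective fun m => X m ω - X n ω := fun a b hab =>
      hω (sub_left_injective hab)
    rw [totalReceivedPower, e2, tsum_image (fun y : Plane => receivedPower Pmax PT α ‖y‖) hinj.injOn,
      tsum_subtype {m | U m ω = false ∧
        ∀ k, U k ω = true → dist (X n ω) (X m ω) ≤ dist (X k ω) (X m ω)}
        fun m => receivedPower Pmax PT α ‖X m ω - X n ω‖]
    refine tsum_congr fun m => ?_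
    rw [Set.indicator_apply, ← dist_eq_norm, dist_comm (X m ω)]
    rfl
  rw [aggregators_inter, tsum_image (f := fun x => totalReceivedPower Pmax PT α
        ((fun y => y - (x : Plane)) '' aggregators X U ω)
        ((fun y => y - (x : Plane)) '' devices X U ω)) hω.injOn]
  simp_rw [e3]
  rw [tsum_subtype {n | U n ω = true ∧ X n ω ∈ B} fun n => ∑' m, if U m ω = false ∧
        ∀ k, U k ω = true → dist (X n ω) (X m ω) ≤ dist (X k ω) (X m ω) then
          receivedPower Pmax PT α (dist (X n ω) (X m ω)) else 0]
  refine Eq.trans ?_ (tsum_subtype {p : ℕ × ℕ | p.1 ≠ p.2} fun p =>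
    (nearestSelected p.1 p.2).indicator 1 (fun k => X k ω, fun k => U k ω) *
          (B.indicator 1 (X p.1 ω) * receivedPower Pmax PT α (dist (X p.1 ω) (X p.2 ω)))).symm
  rw [ENNReal.tsum_prod']
  refine tsum_congr fun n => ?_
  by_cases hn : U n ω = true ∧ X n ω ∈ B
  · rw [Set.indicator_of_mem (by exact hn)]
    refine tsum_congr fun m => ?_
    rcases eq_or_ne n m with rfl | hnm
    · simp [hn.1]
    · rw [Set.indicator_of_mem (by exact hnm), Set.indicator_of_mem hn.2]
      -- The point m is at distance 0 from itself, hence strictly closer than n; taking k = m shows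
      -- that the right side already forces m to be a device.
      have hiff : (U m ω = false ∧
          ∀ k, U k ω = true → dist (X n ω) (X m ω) ≤ dist (X k ω) (X m ω)) ↔
          ((fun k => X k ω, fun k => U k ω) : (ℕ → Plane) × (ℕ → Bool)) ∈
            nearestSelected n m := by
        have hpos : dist (X m ω) (X m ω) < dist (X n ω) (X m ω) := by
          rw [dist_self]
          exact dist_pos.2 fun h => hnm (hω h)
        constructor
        · rintro ⟨-, h⟩
          exact ⟨hn.1, fun k hk => by_contra fun hk' =>
            absurd (h k (by simpa using hk')) (not_le.2 hk)⟩
        · rintro ⟨-, h⟩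
          exact ⟨h m hpos, fun k hk => not_lt.1 fun hlt =>
            Bool.false_ne_true ((h k hlt).symm.trans hk)⟩
      by_cases h : ((fun k => X k ω, fun k => U k ω) : (ℕ → Plane) × (ℕ → Bool)) ∈
            nearestSelected n m
      · rw [if_pos (hiff.2 h), Set.indicator_of_mem h]
        simp
      · rw [if_neg (mt hiff.1 h), Set.indicator_of_notMem h]
        simp
  · rw [Set.indicator_of_notMem (by exact hn)]
    refine (ENNReal.tsum_eq_zero.2 fun m => ?_).symm
    rw [Set.indicator_apply_eq_zero]
    intro _
    rcases not_and_or.1 hn with hn | hn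
    · rw [Set.indicator_of_notMem fun h => hn h.1, zero_mul]
    · rw [Set.indicator_of_notMem hn, zero_mul, mul_zero]

variable [MeasurableSpace Ω] {μ : Measure Ω} [IsProbabilityMeasure μ] {γ lam : ℝ}

lemma IsThinning.prob_false (hU : IsThinning μ γ X U) (hγ : 0 ≤ γ) (n : ℕ) :
    μ {ω | U n ω = false} = ENNReal.ofReal (1 - γ) := by
  have e : {ω | U n ω = false} = {ω | U n ω = true}ᶜ := by ext; simp
  have hm : MeasurableSet {ω | U n ω = true} := hU.measurable n (measurableSet_singleton true)
  rw [e, prob_compl_eq_one_sub hm, hU.prob,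
    ENNReal.ofReal_sub _ hγ, ENNReal.ofReal_one]

lemma IsThinning.prob_true_and_forall_false (hU : IsThinning μ γ X U) (hγ : 0 ≤ γ) {n : ℕ}
    {T : Finset ℕ} (hn : n ∉ T) :
    μ {ω | U n ω = true ∧ ∀ k ∈ T, U k ω = false} =
      ENNReal.ofReal γ * ENNReal.ofReal (1 - γ) ^ T.card := by
  -- This prescribes the mark `true` at `n` and `false` at every other index.
  let s : ℕ → Set Bool := fun k => {decide (k = n)}
  have h := hU.indep.measure_inter_preimage_eq_mul (insert n T) (sets := s)
    fun _ _ => measurableSet_singleton _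
  have e : (⋂ i ∈ insert n T, U i ⁻¹' s i) = {ω | U n ω = true ∧ ∀ k ∈ T, U k ω = false} := by
    ext ω
    have hk : ∀ k ∈ T, (k = n) = False := fun k hk => eq_false fun h => hn (h ▸ hk)
    simp +contextual [s, hk]
  rw [e, Finset.prod_insert hn] at h
  rw [h]
  have h1 : U n ⁻¹' s n = {ω | U n ω = true} := by ext; simp [s]
  have h2 : ∀ k ∈ T, μ (U k ⁻¹' s k) = ENNReal.ofReal (1 - γ) := by
    intro k hk
    have hkn : k ≠ n := fun h => hn (h ▸ hk)
    rw [← hU.prob_false hγ k]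
    congr 1
    ext
    simp [s, hkn]
  rw [h1, hU.prob, Finset.prod_congr rfl h2, Finset.prod_const]

lemma measurableSet_nearestSelected (n m : ℕ) : MeasurableSet (nearestSelected n m) := by
  have hb : ∀ (k : ℕ) (b : Bool), MeasurableSet {c : (ℕ → Plane) × (ℕ → Bool) | c.2 k = b} := by
    intro k b
    have h : Measurable fun c : (ℕ → Plane) × (ℕ → Bool) => c.2 k := by fun_prop
    exact h (measurableSet_singleton b)
  have e : nearestSelected n m = {c | c.2 n = true} ∩
      ⋂ k, ({c | dist (c.1 k) (c.1 m) < dist (c.1 n) (c.1 m)}ᶜ ∪ {c | c.2 k = false}) := by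
    ext c
    simp [nearestSelected, imp_iff_not_or]
  rw [e]
  refine (hb n true).inter (MeasurableSet.iInter fun k => MeasurableSet.union ?_ (hb k false))
  exact (measurableSet_lt (by fun_prop) (by fun_prop)).compl

/-- By independence the joint law of points and marks is a product, so the marks are integrated
first with the points frozen. The event then prescribes finitely many marks: n is selected, and the
points of the open ball, which excludes n, are not. -/
lemma lintegral_nearestSelected (hX : IsPoissonProcess μ lam X) (hU : IsThinning μ γ X U)
    (hγ : 0 ≤ γ) (n m : ℕ) {f : Plane × Plane → ℝ≥0∞} (hf : Measurable f) :
    ∫⁻ ω, (nearestSelected n m).indicator 1 (fun k => X k ω, fun k => U k ω) *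
        f (X n ω, X m ω) ∂μ =
      ENNReal.ofReal γ * ∫⁻ ω, ENNReal.ofReal (1 - γ) ^
        natCount X (Metric.ball (X m ω) (dist (X n ω) (X m ω))) ω * f (X n ω, X m ω) ∂μ := by
  have hXm : Measurable fun ω k => X k ω := measurable_pi_lambda _ hX.measurable
  have hUm : Measurable fun ω k => U k ω := measurable_pi_lambda _ hU.measurable
  have hS := measurableSet_nearestSelected n m
  have hfx : Measurable fun x : ℕ → Plane => f (x n, x m) := hf.comp (by fun_prop)
  have hG : Measurable fun c : (ℕ → Plane) × (ℕ → Bool) =>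
      (nearestSelected n m).indicator (1 : (ℕ → Plane) × (ℕ → Bool) → ℝ≥0∞) c * f (c.1 n, c.1 m) :=
    (measurable_one.indicator hS).mul (hfx.comp measurable_fst)
  have hlaw := (indepFun_iff_map_prod_eq_prod_map_map hXm.aemeasurable hUm.aemeasurable).1
    hU.indep_points
  rw [← lintegral_map (μ := μ) (g := fun ω => ((fun k => X k ω, fun k => U k ω) :
    (ℕ → Plane) × (ℕ → Bool))) hG (hXm.prodMk hUm), hlaw, lintegral_prod _ hG.aemeasurable,
    lintegral_map hG.lintegral_prod_right' hXm, ← lintegral_const_mul' _ _ ENNReal.ofReal_ne_top]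
  refine lintegral_congr_ae ?_
  filter_upwards [ae_forall_count_ball_ne_top hX] with ω hω
  have hfin : {k | X k ω ∈ Metric.ball (X m ω) (dist (X n ω) (X m ω))}.Finite :=
    Set.encard_ne_top_iff.1 (hω (X m ω) (dist (X n ω) (X m ω)))
  have hm : MeasurableSet (Prod.mk (fun k => X k ω) ⁻¹' nearestSelected n m) :=
    measurable_prodMk_left hS
  have hprob : (μ.map fun ω k => U k ω) (Prod.mk (fun k => X k ω) ⁻¹' nearestSelected n m) =
      ENNReal.ofReal γ * ENNReal.ofReal (1 - γ) ^
        natCount X (Metric.ball (X m ω) (dist (X n ω) (X m ω))) ω := by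
    rw [Measure.map_apply hUm hm, natCount, count, hfin.encard_eq_coe_toFinset_card,
      ENat.toNat_natCast, ← hU.prob_true_and_forall_false hγ (n := n)]
    · congr 1
      ext ω'
      simp [nearestSelected]
    · simp
  have hmi : Measurable fun u : ℕ → Bool =>
      (nearestSelected n m).indicator (1 : (ℕ → Plane) × (ℕ → Bool) → ℝ≥0∞) (fun k => X k ω, u) :=
    (measurable_one.indicator hS).comp measurable_prodMk_left
  rw [lintegral_mul_const _ hmi, ← mul_assoc, ← hprob, ← lintegral_indicator_one hm]
  rfl

lemma lintegral_toENNReal_count (hX : IsPoissonProcess μ lam X) {B : Set Plane} (hB : MeasurableSet B)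
    (hB1 : volume B < ∞) :
    ∫⁻ ω, (count X B ω : ℝ≥0∞) ∂μ = ENNReal.ofReal lam * volume B := by
  -- The Poisson mean is the case q = 1.
  have h := lintegral_mul_pow_poissonMeasure (ENNReal.ofReal lam * volume B).toNNReal zero_le_one
  rw [← hX.map_natCount hB hB1, lintegral_map (measurable_of_countable _)
    (measurable_natCount hX.measurable hB),
    ENNReal.coe_toNNReal (ENNReal.mul_ne_top ENNReal.ofReal_ne_top hB1.ne)] at h
  simp only [ENNReal.ofReal_one, one_pow, mul_one, sub_self, mul_zero, neg_zero, Real.exp_zero] at h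
  rw [← h]
  refine lintegral_congr_ae ?_
  filter_upwards [hX.ae_count_ne_top hB hB1] with ω hω
  rw [natCount, ← ENat.toENNReal_coe, ENat.natCast_toNat hω]

/-- The mean number of aggregators in `B`. -/
lemma lintegral_encard_aggregators (hX : IsPoissonProcess μ lam X) (hU : IsThinning μ γ X U)
    {B : Set Plane} (hB : MeasurableSet B) (hB1 : volume B < ∞) :
    ∫⁻ ω, ((aggregators X U ω ∩ B).encard : ℝ≥0∞) ∂μ =
      ENNReal.ofReal γ * (ENNReal.ofReal lam * volume B) := by
  have e : ∀ᵐ ω ∂μ, ((aggregators X U ω ∩ B).encard : ℝ≥0∞) =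
      ∑' n, {ω | U n ω = true}.indicator 1 ω * B.indicator 1 (X n ω) := by
    filter_upwards [hX.injective] with ω hω
    rw [aggregators_inter, hω.encard_image, ← ENNReal.tsum_set_one,
      tsum_subtype {n | U n ω = true ∧ X n ω ∈ B} fun _ => (1 : ℝ≥0∞)]
    refine tsum_congr fun n => ?_
    by_cases h1 : U n ω = true <;> by_cases h2 : X n ω ∈ B <;> simp [h1, h2]
  have hUm : ∀ n, MeasurableSet {ω | U n ω = true} := fun n =>
    hU.measurable n (measurableSet_singleton true)
  have hBm : ∀ n, Measurable fun ω => B.indicator (1 : Plane → ℝ≥0∞) (X n ω) := fun n =>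
    (measurable_one.indicator hB).comp (hX.measurable n)
  have hUBm : ∀ n, AEMeasurable (fun ω => {ω | U n ω = true}.indicator (1 : Ω → ℝ≥0∞) ω *
      B.indicator 1 (X n ω)) μ := fun n =>
    ((measurable_one.indicator (hUm n)).mul (hBm n)).aemeasurable
  rw [lintegral_congr_ae e, lintegral_tsum hUBm, ← lintegral_toENNReal_count hX hB hB1]
  simp_rw [toENNReal_count]
  rw [lintegral_tsum fun n => (hBm n).aemeasurable, ← ENNReal.tsum_mul_left]
  refine tsum_congr fun n => ?_
  have hTm : MeasurableSet {u : ℕ → Bool | u n = true} := by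
    have h : Measurable fun u : ℕ → Bool => u n := by fun_prop
    exact h (measurableSet_singleton true)
  have hind : IndepFun ({ω | U n ω = true}.indicator (1 : Ω → ℝ≥0∞))
      (fun ω => B.indicator (1 : Plane → ℝ≥0∞) (X n ω)) μ := by
    have h := hU.indep_points.symm.comp
      (φ := fun u : ℕ → Bool => ({u | u n = true} : Set (ℕ → Bool)).indicator (1 : (ℕ → Bool) → ℝ≥0∞) u)
      (ψ := fun x : ℕ → Plane => B.indicator (1 : Plane → ℝ≥0∞) (x n))
      (measurable_one.indicator hTm)
      ((measurable_one.indicator hB).comp (measurable_pi_apply n))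
    exact h
  rw [lintegral_mul_eq_lintegral_mul_lintegral_of_indepFun''
    (measurable_one.indicator (hUm n)).aemeasurable (hBm n).aemeasurable hind,
    lintegral_indicator_one (hUm n), hU.prob]

end Thinning

end DataAggregation

/-! ### The mean received power. -/

theorem mainTheorem3 {Ω : Type*} [MeasurableSpace Ω] (μ : Measure Ω) [IsProbabilityMeasure μ]
    (lam γ lamA lamU : ℝ) (hlam : 0 < lam) (hγ0 : 0 < γ) (hγ1 : γ < 1)
    (hlamA : lamA = γ * lam) (hlamU : lamU = lam - lamA)
    (X : ℕ → Ω → DataAggregation.Plane) (U : ℕ → Ω → Bool)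
    (hX : DataAggregation.IsPoissonProcess μ lam X)
    (hU : DataAggregation.IsThinning μ γ X U)
    (Pmax PT α rc : ℝ) (hPmax : 0 < Pmax) (hPT : 0 < PT) (hα : 0 < α)
    (hrc : rc = DataAggregation.criticalDistance Pmax PT α)
    (B : Set DataAggregation.Plane) (hB : MeasurableSet B)
    (hB0 : 0 < volume B) (hB1 : volume B < ∞) :
    DataAggregation.palmExpectation μ (DataAggregation.aggregators X U)
        (DataAggregation.devices X U) B (DataAggregation.totalReceivedPower Pmax PT α) =
      ENNReal.ofReal
        (lamU / lamA * (1 - Real.exp (-(Real.pi * lamA * rc ^ 2))) * PT +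
          Real.pi * lamU / (Real.pi * lamA) ^ (1 - α / 2) * Pmax *
            DataAggregation.upperIncompleteGamma (1 - α / 2) (Real.pi * lamA * rc ^ 2)) := by
  have hq0 : 0 ≤ 1 - γ := by linarith
  have hq1 : 1 - γ ≤ 1 := by linarith
  have hA : 0 < lamA := hlamA ▸ mul_pos hγ0 hlam
  have hc : 0 < Real.pi * lamA := mul_pos Real.pi_pos hA
  let f : DataAggregation.Plane × DataAggregation.Plane → ℝ≥0∞ := fun z =>
    B.indicator 1 z.1 * DataAggregation.receivedPower Pmax PT α (dist z.1 z.2)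
  have hf : Measurable f :=
    ((measurable_one.indicator hB).comp measurable_fst).mul
      ((DataAggregation.measurable_receivedPower Pmax PT α).comp (by fun_prop))
  have hfC : ∀ z, f z ≤ ENNReal.ofReal PT := by
    intro z
    have h1 : B.indicator (1 : DataAggregation.Plane → ℝ≥0∞) z.1 ≤ 1 :=
      Set.indicator_le_self' (fun _ _ => zero_le) _
    calc f z ≤ 1 * ENNReal.ofReal PT := mul_le_mul' h1 (min_le_right _ _)
      _ = _ := one_mul _
  have hXX : ∀ n m, Measurable fun ω => (X n ω, X m ω) := fun n m =>
    (hX.measurable n).prodMk (hX.measurable m)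
  have hUX : Measurable fun ω => ((fun k => X k ω, fun k => U k ω) :
      (ℕ → DataAggregation.Plane) × (ℕ → Bool)) :=
    (measurable_pi_lambda _ hX.measurable).prodMk (measurable_pi_lambda _ hU.measurable)
  have hnum : ∫⁻ ω, ∑' x : ↥(DataAggregation.aggregators X U ω ∩ B),
      DataAggregation.totalReceivedPower Pmax PT α
        ((fun y => y - (x : DataAggregation.Plane)) '' DataAggregation.aggregators X U ω)
        ((fun y => y - (x : DataAggregation.Plane)) '' DataAggregation.devices X U ω) ∂μ =
      ENNReal.ofReal γ * (ENNReal.ofReal lam * volume B) * (ENNReal.ofReal lamU *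
        ∫⁻ y : DataAggregation.Plane, ENNReal.ofReal (Real.exp (-(Real.pi * lamA * ‖y‖ ^ 2))) *
          DataAggregation.receivedPower Pmax PT α ‖y‖) := by
    have hg : Measurable fun r : ℝ => ENNReal.ofReal (Real.exp (-(Real.pi * lamA * r ^ 2))) *
        DataAggregation.receivedPower Pmax PT α r :=
      Measurable.mul (by fun_prop) (DataAggregation.measurable_receivedPower Pmax PT α)
    rw [lintegral_congr_ae (hX.injective.mono fun ω hω =>
      DataAggregation.tsum_totalReceivedPower B hω), lintegral_tsum]
    · refine (tsum_congr fun p : {p : ℕ × ℕ // p.1 ≠ p.2} =>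
        DataAggregation.lintegral_nearestSelected hX hU hγ0.le p.1.1 p.1.2 hf).trans ?_
      rw [ENNReal.tsum_mul_left, DataAggregation.tsum_lintegral_pow_natCount_ball hX hlam.le hq0 hq1 hf
          ENNReal.ofReal_ne_top hfC]
      -- One factor λ joins 1 - γ to form λ_u; the other is kept for the mean number γλ|B| of
      -- aggregators, which cancels against the denominator.
      have e : ∀ z : DataAggregation.Plane × DataAggregation.Plane, ENNReal.ofReal lam ^ 2 *
          ENNReal.ofReal (Real.exp (-(lam * (1 - (1 - γ)) * (dist z.1 z.2 ^ 2 * Real.pi)))) *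
          ENNReal.ofReal (1 - γ) * f z = ENNReal.ofReal lam * ENNReal.ofReal lamU *
          (B.indicator 1 z.1 * (ENNReal.ofReal (Real.exp (-(Real.pi * lamA * dist z.1 z.2 ^ 2))) *
            DataAggregation.receivedPower Pmax PT α (dist z.1 z.2))) := by
        intro z
        have h1 : lam * (1 - (1 - γ)) * (dist z.1 z.2 ^ 2 * Real.pi) =
            Real.pi * lamA * dist z.1 z.2 ^ 2 := by rw [hlamA]; ring
        have h2 : ENNReal.ofReal lamU = ENNReal.ofReal lam * ENNReal.ofReal (1 - γ) := by
          rw [← ENNReal.ofReal_mul hlam.le, hlamU, hlamA]; ring_nf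
        rw [h1, h2]
        simp only [f]
        ring
      simp_rw [e]
      rw [lintegral_const_mul' _ _ (by finiteness),
        DataAggregation.lintegral_prod_indicator_mul_dist hB hg]
      ring
    · intro p
      exact (((measurable_one.indicator
        (DataAggregation.measurableSet_nearestSelected p.1.1 p.1.2)).comp hUX).mul
        (hf.comp (hXX p.1.1 p.1.2))).aemeasurable
  have hden0 : ENNReal.ofReal γ * (ENNReal.ofReal lam * volume B) ≠ 0 := by
    simp [hγ0, hlam, hB0.ne']
  have hden1 : ENNReal.ofReal γ * (ENNReal.ofReal lam * volume B) ≠ ∞ := by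
    have := hB1.ne
    finiteness
  rw [DataAggregation.palmExpectation, hnum,
    DataAggregation.lintegral_encard_aggregators hX hU hB hB1, mul_comm, mul_div_assoc,
    ENNReal.div_self hden0 hden1, mul_one,
    DataAggregation.lintegral_exp_mul_receivedPower hc hPmax hPT hα, ← hrc,
    ← ENNReal.ofReal_mul (by rw [hlamU, hlamA]; nlinarith)]
  congr 1
  have := Real.pi_pos
  field_simp
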